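/- Model II. Let $k\ge 1$ be a fixed integer. There are $n$ items, and an unknown function $g:[n]\to\mathbb Z/k\mathbb Z$ assigns each item to one of $k$ groups numbered $0,\dots,k-1$ and arranged modulo $k$. Let $0<q<\tfrac12$ (equivalently, the gap $c=\tfrac12-q$ satisfies $0<c<\tfrac12$). A query of a pair $e=(x,y)$ of distinct items returns $$\tilde f(e)=\begin{cases} g(x)-g(y) \bmod k & \text{with probability } 1-q,\\ g(x)-g(y)+1 \bmod k & \text{with probability } q/2,\\ g(x)-g(y)-1 \bmod k & \text{with probability } q/2,\end{cases}$$ with independent errors for distinct unordered pairs; querying the same pair again returns the same answer. Theorem. For every fixed $k$ there are a deterministic algorithm (a program for a random access machine that is given $n$ and the answers to its queries, but neither $g$ nor $q$), a polynomial $p$, and a function $m:\mathbb N\to\mathbb N$ with $$m(n)=O\!\left(n^{1+\frac{1}{\log\log n}}\log n\right)$$ such that the following hold. 1. On $n$ items the algorithm always halts after at most $p(n)$ steps and makes at most $m(n)$ queries, whatever pairs are queried and whatever the errors are. 2. Suppose that the queried pairs are independent, uniformly random pairs of distinct items, independent of the errors. Then for every constant $q$ with $0<q<\tfrac12$ and every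 sequence of assignments $g_n:[n]\to\mathbb Z/k\mathbb Z$, the algorithm recovers the clusters with probability tending to $1$ as $n\to\infty$: it outputs a labelling of the items in which two items $x,y$ have the same label if and only if $g_n(x)=g_n(y)$. -/

import Mathlib

namespace NoisyClustering

open MeasureTheory

/-! ### The query model

The items are `Fin n`, the groups are the residues `ZMod k`, and `g : Fin n → ZMod k` is the hidden
assignment of items to groups. -/

/-- The pairs of distinct items; every unordered pair occurs exactly once. -/
abbrev Pair (n : ℕ) : Type := {e : Fin n × Fin n // e.1 < e.2}

/-- The law of the error of one pair: `0` with probability `1 - q`, and `1`, `-1` (modulo `k`) with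
probability `q / 2` each. -/
noncomputable def errorLaw (k : ℕ) (q : ℝ) : Measure (ZMod k) :=
  ENNReal.ofReal (1 - q) • Measure.dirac 0 +
    (ENNReal.ofReal (q / 2) • Measure.dirac 1 + ENNReal.ofReal (q / 2) • Measure.dirac (-1))

/-- The value reported for the pair `e = (x, y)`, namely `g x - g y` plus the error of that pair.
The error belongs to the pair: asking the same pair again gives the same value. -/
def answer {k n : ℕ} (g : Fin n → ZMod k) (err : Pair n → ZMod k) (e : Pair n) : ZMod k :=
  g e.1.1 - g e.1.2 + err e

/-- The joint law of the errors (independent over the pairs) and of `m` queried pairs (independent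
of each other and of the errors, each of them uniform among all pairs). -/
noncomputable def modelLaw (k n m : ℕ) (q : ℝ) :
    Measure ((Pair n → ZMod k) × (Fin m → Pair n)) :=
  (Measure.pi fun _ : Pair n => errorLaw k q).prod
    (Measure.pi fun _ : Fin m => ProbabilityTheory.uniformOn (Set.univ : Set (Pair n)))

/-- What a program is told by the `m` queries: the two items of the pair and the value reported for
it, all three as natural numbers (the value as the representative in `{0, …, k - 1}`). -/
def responses {k n m : ℕ} (g : Fin n → ZMod k) (err : Pair n → ZMod k) (e : Fin m → Pair n) :
    Fin m → ℕ × ℕ × ℕ :=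
  fun i => ((e i).1.1, (e i).1.2, (answer g err (e i)).val)

/-! ### Algorithms: structured programs for a random access machine

A program works on finitely many natural-number variables and arrays. The only arithmetic is
addition and truncated subtraction, and it is charged per operation; since there is no
multiplication, numbers have at most linearly many bits in the number of steps, so that running
times agree with those of Turing machines up to a polynomial. -/

/-- Expressions: constants, variables, array cells `a[i]`, sums and truncated differences. -/
inductive Expr : Type
  | lit (c : ℕ)
  | var (v : ℕ)
  | get (a : ℕ) (i : Expr)
  | add (e₁ e₂ : Expr)
  | sub (e₁ e₂ : Expr)

/-- Programs. `loop e c` is "while `e ≠ 0` do `c`"; `ite e c d` runs `c` if `e ≠ 0` and `d`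
otherwise; `put a i e` is `a[i] := e`; `query x y r` makes one query and stores the two items of
the pair and the reported value in the variables `x`, `y`, `r`. -/
inductive Prog : Type
  | skip
  | assign (v : ℕ) (e : Expr)
  | put (a : ℕ) (i e : Expr)
  | query (x y r : ℕ)
  | seq (c d : Prog)
  | ite (e : Expr) (c d : Prog)
  | loop (e : Expr) (c : Prog)

/-- The contents of the variables and of the arrays, and the number of queries made so far. -/
structure State : Type where
  var : ℕ → ℕ
  arr : ℕ → ℕ → ℕ
  asked : ℕ

/-- The initial state on `n` items: variable `0` holds `n`, everything else is `0`. -/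
def State.init (n : ℕ) : State where
  var := Function.update (fun _ => 0) 0 n
  arr := fun _ _ => 0
  asked := 0

def State.setVar (s : State) (v c : ℕ) : State :=
  { s with var := Function.update s.var v c }

def State.setArr (s : State) (a i c : ℕ) : State :=
  { s with arr := Function.update s.arr a (Function.update (s.arr a) i c) }

def Expr.eval (s : State) : Expr → ℕ
  | .lit c => c
  | .var v => s.var v
  | .get a i => s.arr a (i.eval s)
  | .add e₁ e₂ => e₁.eval s + e₂.eval s
  | .sub e₁ e₂ => e₁.eval s - e₂.eval s

/-- The number of steps for evaluating an expression. -/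
def Expr.cost : Expr → ℕ
  | .lit _ => 1
  | .var _ => 1
  | .get _ i => i.cost + 1
  | .add e₁ e₂ => e₁.cost + e₂.cost + 1
  | .sub e₁ e₂ => e₁.cost + e₂.cost + 1

/-- `Exec resp c s t T`: started in state `s`, the program `c` halts in state `t` after exactly `T`
steps, where the queries, in the order in which they are made, return `resp 0, resp 1, …`. A run
cannot make more than `m` queries: with all `m` responses used up, a further query has no
transition. -/
inductive Exec {m : ℕ} (resp : Fin m → ℕ × ℕ × ℕ) : Prog → State → State → ℕ → Prop
  | skip (s : State) : Exec resp .skip s s 1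
  | assign (s : State) (v : ℕ) (e : Expr) :
      Exec resp (.assign v e) s (s.setVar v (e.eval s)) (e.cost + 1)
  | put (s : State) (a : ℕ) (i e : Expr) :
      Exec resp (.put a i e) s (s.setArr a (i.eval s) (e.eval s)) (i.cost + e.cost + 1)
  | query (s : State) (x y r : ℕ) (h : s.asked < m) :
      Exec resp (.query x y r) s
        { (((s.setVar x (resp ⟨s.asked, h⟩).1).setVar y (resp ⟨s.asked, h⟩).2.1).setVar r
            (resp ⟨s.asked, h⟩).2.2) with asked := s.asked + 1 } 1
  | seq {s t u : State} {c d : Prog} {T U : ℕ} :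
      Exec resp c s t T → Exec resp d t u U → Exec resp (.seq c d) s u (T + U)
  | ite_true {s t : State} {e : Expr} {c d : Prog} {T : ℕ} :
      e.eval s ≠ 0 → Exec resp c s t T → Exec resp (.ite e c d) s t (e.cost + T)
  | ite_false {s t : State} {e : Expr} {c d : Prog} {T : ℕ} :
      e.eval s = 0 → Exec resp d s t T → Exec resp (.ite e c d) s t (e.cost + T)
  | loop_done {s : State} {e : Expr} {c : Prog} :
      e.eval s = 0 → Exec resp (.loop e c) s s e.cost
  | loop_step {s t u : State} {e : Expr} {c : Prog} {T U : ℕ} :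
      e.eval s ≠ 0 → Exec resp c s t T → Exec resp (.loop e c) t u U →
        Exec resp (.loop e c) s u (e.cost + T + U)

/-- The output is the labelling `x ↦ a[x]` of the items by array `0`. It recovers the clusters if
two items have the same label exactly when they are in the same group. -/
def Recovers {k n : ℕ} (g : Fin n → ZMod k) (t : State) : Prop :=
  ∀ x y : Fin n, t.arr 0 x = t.arr 0 y ↔ g x = g y

/-- The event that the program halts with the clusters recovered. -/
def successEvent {k n : ℕ} (m : ℕ) (P : Prog) (g : Fin n → ZMod k) :
    Set ((Pair n → ZMod k) × (Fin m → Pair n)) :=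
  {w | ∃ (t : State) (T : ℕ), Exec (responses g w.1 w.2) P (State.init n) t T ∧ Recovers g t}

end NoisyClustering

/-!
The algorithm grows `G` search trees from the item `0`. Tree number `ρ` uses its own share of the
queries and its own block of `s` items; every edge of it has an end in the block, and only the items
of the block and the root are ever extended. It is grown in `2 w` rounds, each of which uses fresh
queries and attaches to the items reached before the round, so that every path has at most `2 w`
pairs. A tree that reaches the item `x` estimates `g x - g 0` by the sum of the answers along its
path; `x` gets the estimate with the most votes. The parameters are powers of two that depend on a
level `w`, roughly the cube root of `log₂ n`: `G = 2 ^ w²`, `s = 2 G ^ w`, and `n G ^ 15` queries per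
round. The number of queries is `n * 2 w * G ^ 16`, and `G ^ 16 = 2 ^ (16 w²)` is far below
`n ^ (1 / log log n)`, whose exponent to the base `2` is of the order `w³ / log w`.

*Every tree reaches every item.* By a union bound over all pairs of small sets `S`, `T`, with high
probability every round of every tree expands: the queries of the round join any `G ^ j` items to
more than `G ^ (j + 1)` items of the block (`queryLaw_not_expanding_le`). As this holds for all sets
at once, no conditioning on the tree is needed. Growing from the root, the tree covers more than half
of its block after `w` rounds; growing backwards from an item that is not reached at the end, more
than half of the block is not reached after `w` rounds
(`Exploration.grow_stage_ne_zero_of_expanding`).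

*The votes are right.* Which paths are used depends on the queries only. Running the same trees with
formal answers in `Pair n → ℤ` shows that the path to `x` consists of at most `2 w` different pairs
with signs (`Symbolic`), and for fixed `x` the paths in different trees have no pair in common
(`not_touches_of_touches`), so that their errors are independent (`iIndepFun_evalPairs`). One error
is, with probability `1 - 2 q`, equal to `0` and otherwise a step of the lazy walk. The lazy walk is
the composition of a walk with its reverse, hence most likely to be at its starting point
(`lazyStep_pow_nonneg`), and so the sum of the errors along a path prefers the value `0` to any other
value by at least `(1 - 2 q) ^ (2 w)` (`le_errorStep_pow`). Hoeffding's inequality bounds the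
probability of a wrong vote by `exp (- G (1 - 2 q) ^ (4 w) / 2)` (`errorsLaw_vote_le`), which beats
the number `n` of items because `G = 2 ^ w²` outgrows both `(1 - 2 q) ^ (- 4 w)` and
`log n = O(w³)`.

The program itself consists of counting loops and is verified by Hoare triples that carry time bounds
(`Triple`, `triple_clustering`).
-/

namespace NoisyClustering

open MeasureTheory

/-! ### Total correctness of programs -/

/-- Total correctness with a time bound: started in a state with `P`, the program `c` halts after at
most `B` steps in a state with `Q`. -/
def Triple {m : ℕ} (resp : Fin m → ℕ × ℕ × ℕ) (P : State → Prop) (c : Prog) (Q : State → Prop)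
    (B : ℕ) : Prop :=
  ∀ s, P s → ∃ (t : State) (T : ℕ), Exec resp c s t T ∧ T ≤ B ∧ Q t

section Rules

variable {m : ℕ} {resp : Fin m → ℕ × ℕ × ℕ} {P Q R : State → Prop} {c d : Prog} {B C : ℕ}

theorem Triple.conseq {P' Q' : State → Prop} {B' : ℕ} (h : Triple resp P' c Q' B')
    (hP : ∀ s, P s → P' s) (hQ : ∀ s, Q' s → Q s) (hB : B' ≤ B) : Triple resp P c Q B := by
  intro s hs
  obtain ⟨t, T, h1, h2, h3⟩ := h s (hP s hs)
  exact ⟨t, T, h1, h2.trans hB, hQ t h3⟩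

theorem Triple.skip (h : ∀ s, P s → Q s) : Triple resp P .skip Q 1 :=
  fun s hs => ⟨s, 1, .skip s, le_rfl, h s hs⟩

theorem Triple.assign {v : ℕ} {e : Expr} (h : ∀ s, P s → Q (s.setVar v (e.eval s))) :
    Triple resp P (.assign v e) Q (e.cost + 1) :=
  fun s hs => ⟨_, _, .assign s v e, le_rfl, h s hs⟩

theorem Triple.put {a : ℕ} {i e : Expr} (h : ∀ s, P s → Q (s.setArr a (i.eval s) (e.eval s))) :
    Triple resp P (.put a i e) Q (i.cost + e.cost + 1) :=
  fun s hs => ⟨_, _, .put s a i e, le_rfl, h s hs⟩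

theorem Triple.query {x y r : ℕ} (h : ∀ s, P s → ∃ h : s.asked < m,
    Q { (((s.setVar x (resp ⟨s.asked, h⟩).1).setVar y (resp ⟨s.asked, h⟩).2.1).setVar r
            (resp ⟨s.asked, h⟩).2.2) with asked := s.asked + 1 }) :
    Triple resp P (.query x y r) Q 1 := by
  intro s hs
  obtain ⟨h1, h2⟩ := h s hs
  exact ⟨_, _, .query s x y r h1, le_rfl, h2⟩

theorem Triple.seq (h₁ : Triple resp P c Q B) (h₂ : Triple resp Q d R C) :
    Triple resp P (.seq c d) R (B + C) := by
  intro s hs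
  obtain ⟨t, T, h1, h2, h3⟩ := h₁ s hs
  obtain ⟨u, U, h4, h5, h6⟩ := h₂ t h3
  exact ⟨u, T + U, .seq h1 h4, Nat.add_le_add h2 h5, h6⟩

theorem Triple.ite {e : Expr} (h₁ : Triple resp (fun s => P s ∧ e.eval s ≠ 0) c Q B)
    (h₂ : Triple resp (fun s => P s ∧ e.eval s = 0) d Q B) :
    Triple resp P (.ite e c d) Q (e.cost + B) := by
  intro s hs
  by_cases he : e.eval s = 0
  · obtain ⟨t, T, h1, h2, h3⟩ := h₂ s ⟨hs, he⟩
    exact ⟨t, _, .ite_false he h1, by omega, h3⟩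
  · obtain ⟨t, T, h1, h2, h3⟩ := h₁ s ⟨hs, he⟩
    exact ⟨t, _, .ite_true he h1, by omega, h3⟩

/-- The counting loop `for v := 0, …, e - 1 do c`; the body may change neither `v` nor the value of
the bound `e`. -/
def Prog.forN (v : ℕ) (e : Expr) (c : Prog) : Prog :=
  .seq (.assign v (.lit 0))
    (.loop (.sub e (.var v)) (.seq c (.assign v (.add (.var v) (.lit 1)))))

/-- The rule for counting loops with invariant `I i` at the beginning of the pass with `v = i`. -/
theorem Triple.forN {v : ℕ} {e : Expr} {N : ℕ} (I : ℕ → State → Prop)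
    (hstart : ∀ s, P s → I 0 (s.setVar v 0)) (hN : ∀ i s, I i s → e.eval s = N)
    (hv : ∀ i s, I i s → s.var v = i) (hend : ∀ s, I N s → Q s)
    (hbody : ∀ i < N, Triple resp (I i) c (fun t => I (i + 1) (t.setVar v (t.var v + 1))) B) :
    Triple resp P (Prog.forN v e c) Q (N * (B + e.cost + 6) + e.cost + 4) := by
  have key : ∀ d i s, i + d = N → I i s → ∃ (t : State) (T : ℕ),
      Exec resp (.loop (.sub e (.var v)) (.seq c (.assign v (.add (.var v) (.lit 1))))) s t T ∧
        T ≤ d * (B + e.cost + 6) + e.cost + 2 ∧ I N t := by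
    intro d
    induction d with
    | zero =>
      intro i s hi hs
      have h1 := hN i s hs
      have h2 := hv i s hs
      refine ⟨s, _, .loop_done (by simp [Expr.eval]; omega), by simp [Expr.cost], ?_⟩
      have : i = N := by omega
      exact this ▸ hs
    | succ d ih =>
      intro i s hi hs
      have h1 := hN i s hs
      have h2 := hv i s hs
      obtain ⟨t, T, ht, hT, hI⟩ := hbody i (by omega) s hs
      obtain ⟨u, U, hu, hU, hI'⟩ := ih (i + 1) _ (by omega) hI
      refine ⟨u, _, .loop_step (by simp [Expr.eval]; omega) (.seq ht (.assign t v _)) hu, ?_, hI'⟩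
      simp only [Expr.cost, Nat.succ_mul]
      omega
  intro s hs
  obtain ⟨t, T, ht, hT, hI⟩ := key N 0 _ (by omega) (hstart s hs)
  exact ⟨t, _, .seq (.assign s v (.lit 0)) ht, by simp only [Expr.cost]; omega, hend t hI⟩

end Rules

/-! ### Boolean and arithmetic expressions -/

/-- Conjunction, where nonzero means true. -/
def Expr.and (a b : Expr) : Expr :=
  .sub (.lit 1) (.add (.sub (.lit 1) a) (.sub (.lit 1) b))

theorem Expr.eval_and_ne_zero {s : State} {a b : Expr} :
    (Expr.and a b).eval s ≠ 0 ↔ a.eval s ≠ 0 ∧ b.eval s ≠ 0 := by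
  simp only [Expr.and, Expr.eval]; omega

/-- The product of an expression with the constant `k`. -/
def Expr.mulLit : ℕ → Expr → Expr
  | 0, _ => .lit 0
  | k + 1, e => .add (Expr.mulLit k e) e

theorem Expr.eval_mulLit (s : State) (k : ℕ) (e : Expr) :
    (Expr.mulLit k e).eval s = e.eval s * k := by
  induction k with
  | zero => simp [mulLit, eval]
  | succ k ih => simp [mulLit, eval, ih, Nat.mul_succ]

@[simp] theorem State.setVar_var (s : State) (v c u : ℕ) :
    (s.setVar v c).var u = if u = v then c else s.var u := by
  simp [State.setVar, Function.update_apply]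

@[simp] theorem State.setVar_arr (s : State) (v c : ℕ) : (s.setVar v c).arr = s.arr := rfl

@[simp] theorem State.setVar_asked (s : State) (v c : ℕ) : (s.setVar v c).asked = s.asked := rfl

@[simp] theorem State.setArr_var (s : State) (a i c : ℕ) : (s.setArr a i c).var = s.var := rfl

@[simp] theorem State.setArr_asked (s : State) (a i c : ℕ) :
    (s.setArr a i c).asked = s.asked := rfl

@[simp] theorem State.setArr_arr (s : State) (a i c b : ℕ) :
    (s.setArr a i c).arr b = if b = a then Function.update (s.arr a) i c else s.arr b := by
  by_cases h : b = a
  · subst h; simp [State.setArr]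
  · simp [State.setArr, h]

/-! ### Multiplication by powers of two -/

/-- `s` and `t` differ at most in the variables listed in `vs`. -/
def SameExcept (vs : List ℕ) (s t : State) : Prop :=
  t.arr = s.arr ∧ t.asked = s.asked ∧ ∀ u, u ∉ vs → t.var u = s.var u

/-- Multiplies the variable `v` by `2 ^ (a * b * c)`. -/
def Prog.scale (v : ℕ) (a b c : Expr) : Prog :=
  .forN 3 a (.forN 4 b (.forN 5 c (.assign v (.add (.var v) (.var v)))))

theorem triple_scale {m : ℕ} {resp : Fin m → ℕ × ℕ × ℕ} {v : ℕ} {a b c : Expr} (s₀ : State)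
    (A B C : ℕ) (hv : v ≠ 3 ∧ v ≠ 4 ∧ v ≠ 5)
    (ha : ∀ t, SameExcept [3, 4, 5, v] s₀ t → a.eval t = A)
    (hb : ∀ t, SameExcept [3, 4, 5, v] s₀ t → b.eval t = B)
    (hc : ∀ t, SameExcept [3, 4, 5, v] s₀ t → c.eval t = C) :
    Triple resp (fun s => s = s₀) (Prog.scale v a b c)
      (fun t => SameExcept [3, 4, 5, v] s₀ t ∧ t.var v = s₀.var v * 2 ^ (A * B * C))
      (A * ((B * ((C * (4 + c.cost + 6) + c.cost + 4) + b.cost + 6) + b.cost + 4) + a.cost + 6)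
        + a.cost + 4) := by
  obtain ⟨h3, h4, h5⟩ := hv
  have upd : ∀ t u z, u ∈ [3, 4, 5, v] → SameExcept [3, 4, 5, v] s₀ t →
      SameExcept [3, 4, 5, v] s₀ (t.setVar u z) := by
    rintro t u z hu ⟨e1, e2, e3⟩
    refine ⟨e1, e2, fun x hx => ?_⟩
    have : x ≠ u := fun h => hx (h ▸ hu)
    simp [this, e3 x hx]
  refine Triple.forN (fun i t => SameExcept [3, 4, 5, v] s₀ t ∧ t.var 3 = i ∧
    t.var v = s₀.var v * 2 ^ (i * B * C)) ?_ (fun i s h => ha s h.1) (fun i s h => h.2.1)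
    (fun s h => ⟨h.1, h.2.2⟩) ?_
  · rintro s rfl
    exact ⟨upd _ _ _ (by simp) ⟨rfl, rfl, fun _ _ => rfl⟩, by simp, by simp [h3]⟩
  intro i _
  refine Triple.forN (fun j t => SameExcept [3, 4, 5, v] s₀ t ∧ t.var 3 = i ∧ t.var 4 = j ∧
    t.var v = s₀.var v * 2 ^ (i * B * C + j * C)) ?_ (fun i s h => hb s h.1)
    (fun i s h => h.2.2.1) ?_ ?_
  · rintro s ⟨e1, e2, e3⟩
    exact ⟨upd _ _ _ (by simp) e1, by simp [e2], by simp, by simp [h4, e3]⟩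
  · rintro s ⟨e1, e2, e3, e4⟩
    refine ⟨upd _ _ _ (by simp) e1, by simp [e2], ?_⟩
    simp only [State.setVar_var, h3, if_false, e4]
    ring
  intro j _
  refine Triple.forN (fun l t => SameExcept [3, 4, 5, v] s₀ t ∧ t.var 3 = i ∧ t.var 4 = j ∧
    t.var 5 = l ∧ t.var v = s₀.var v * 2 ^ (i * B * C + j * C + l)) ?_ (fun i s h => hc s h.1)
    (fun i s h => h.2.2.2.1) ?_ ?_
  · rintro s ⟨e1, e2, e3, e4⟩
    exact ⟨upd _ _ _ (by simp) e1, by simp [e2], by simp [e3], by simp, by simp [h5, e4]⟩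
  · rintro s ⟨e1, e2, e3, e4, e5⟩
    refine ⟨upd _ _ _ (by simp) e1, by simp [e2], by simp [e3], ?_⟩
    simp only [State.setVar_var, h4, if_false, e5]
    ring
  intro l _
  refine Triple.assign ?_
  rintro s ⟨e1, e2, e3, e4, e5⟩
  refine ⟨upd _ _ _ (by simp) (upd _ _ _ (by simp) e1), by simp [e2, Ne.symm h3],
    by simp [e3, Ne.symm h4], by simp [e4, Ne.symm h5], ?_⟩
  simp only [State.setVar_var, h5, if_false, if_true, Expr.eval, e5]
  ring

/-! ### The parameters of the algorithm -/

/-- The number of items needed to run the algorithm at level `w`, that is, to accommodate `fan`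
blocks of size `blockSize` besides the item `0`. -/
def threshold (w : ℕ) : ℕ := 2 * 2 ^ (w * w * (w + 1))

/-- The level at which the algorithm runs on `n` items, about the cube root of `log₂ n`. -/
def level (n : ℕ) : ℕ := Nat.findGreatest (fun w => threshold w < n) n

/-- The number of search trees; it is also the factor by which a search tree grows per round. -/
def fan (n : ℕ) : ℕ := 2 ^ (level n * level n)

/-- The number of items in a block. -/
def blockSize (n : ℕ) : ℕ := 2 * 2 ^ (level n * level n * level n)

/-- The number of queries used for one round of growth of one search tree. The exponent `15` leaves
room for the ratio `n / blockSize n ≤ fan n ^ 12`, for the growth by the factor `fan n`, and for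
the union bound. -/
def roundLength (n : ℕ) : ℕ := n * 2 ^ (level n * level n * 15)

/-- The total number of queries: `fan n` trees with `2 * level n` rounds each. -/
def queryCount (n : ℕ) : ℕ := fan n * ((level n + level n) * roundLength n)

/-! ### Search trees -/

/-- A search tree rooted at the item `0`, with labels in `A`: `stage v` is one more than the number
of rounds after which `v` has been reached, and `0` if `v` has not been reached; `lab v` is the sum
of the answers along the tree path to `v`. -/
structure Exploration (A : Type*) where
  stage : ℕ → ℕ
  lab : ℕ → A

namespace Exploration

variable {A : Type*} [AddGroup A]

/-- The search tree that consists of the root only. -/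
def root : Exploration A where
  stage v := if v = 0 then 1 else 0
  lab _ := 0

/-- `v` may be attached to `u` in round `i`: `u` was reached before this round, `v` has not been
reached, and the edge leads from the block `[lo, lo + s)` to anywhere or from the root into the
block. -/
def Usable (lo s i : ℕ) (T : Exploration A) (u v : ℕ) : Prop :=
  ((lo ≤ u ∧ u < lo + s) ∨ (u = 0 ∧ lo ≤ v ∧ v < lo + s)) ∧
    T.stage u ≠ 0 ∧ T.stage u ≤ i + 1 ∧ T.stage v = 0

instance (lo s i : ℕ) (T : Exploration A) (u v : ℕ) : Decidable (T.Usable lo s i u v) :=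
  inferInstanceAs (Decidable (_ ∧ _))

/-- Attaches `v`, with the label `a`, to `u` if this is allowed in round `i`. -/
def relax (lo s i u v : ℕ) (a : A) (T : Exploration A) : Exploration A :=
  if T.Usable lo s i u v then ⟨Function.update T.stage v (i + 2), Function.update T.lab v a⟩ else T

/-- Processes the answer `r`, an estimate of `g x - g y`, for the pair `(x, y)` in round `i`. -/
def visit (lo s i x y : ℕ) (r : A) (T : Exploration A) : Exploration A :=
  let T' := T.relax lo s i x y (T.lab x - r)
  T'.relax lo s i y x (T'.lab y + r)

/-- Processes the first `τ` queries `q` with answers `r` of round `i`. -/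
def round (lo s i : ℕ) (q : ℕ → ℕ × ℕ) (r : ℕ → A) : ℕ → Exploration A → Exploration A
  | 0, T => T
  | τ + 1, T => (round lo s i q r τ T).visit lo s i (q τ).1 (q τ).2 (r τ)

/-- The search tree after the given number of rounds of `Q` queries each. -/
def grow (lo s Q : ℕ) (q : ℕ → ℕ × ℕ) (r : ℕ → A) : ℕ → Exploration A
  | 0 => root
  | i + 1 => (grow lo s Q q r i).round lo s i (fun τ => q (i * Q + τ)) (fun τ => r (i * Q + τ)) Q

end Exploration

/-- The search tree number `ρ`, grown from its own share of the queries through its own block. -/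
def searchTree {A : Type*} [AddGroup A] (n : ℕ) (q : ℕ → ℕ × ℕ) (r : ℕ → A) (ρ i : ℕ) :
    Exploration A :=
  Exploration.grow (1 + ρ * blockSize n) (blockSize n) (roundLength n)
    (fun j => q (ρ * ((level n + level n) * roundLength n) + j))
    (fun j => r (ρ * ((level n + level n) * roundLength n) + j)) i

open Classical in
/-- The number of those among the first `R` search trees that give the label `c` to the item
`x`. -/
noncomputable def votes {k : ℕ} (n : ℕ) (q : ℕ → ℕ × ℕ) (r : ℕ → ZMod k) (R x : ℕ) (c : ZMod k) :
    ℕ :=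
  ((Finset.range R).filter fun ρ => (searchTree n q r ρ (level n + level n)).stage x ≠ 0 ∧
    (searchTree n q r ρ (level n + level n)).lab x = c).card

/-! ### The program -/

/-
Variables: `0` number of items, `1` level, `6` number of trees, `7` block size, `8` round length,
`9` tree, `10` round, `11` query within the round, `12`, `13`, `14` last query and its answer,
`15` first item of the block, `16` new label, `17` item, `18`, `19` candidate labels; the others are
used for computing the parameters.
Arrays: `0` output, `1` stages, `2` labels (in `{0, …, k - 1}`), `3` votes.
-/

/-- Computes the level in variable `1`, the number of trees in `6`, the block size in `7` and the
length of a round in `8`. -/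
def Prog.params : Prog :=
  .seq (.forN 20 (.var 0) (.seq (.assign 2 (.lit 2)) (.seq
      (.scale 2 (.add (.var 20) (.lit 1)) (.add (.var 20) (.lit 1)) (.add (.var 20) (.lit 2)))
      (.ite (.sub (.var 0) (.var 2)) (.assign 1 (.add (.var 20) (.lit 1))) .skip)))) <|
  .seq (.assign 6 (.lit 1)) <| .seq (.scale 6 (.var 1) (.var 1) (.lit 1)) <|
  .seq (.assign 7 (.lit 2)) <| .seq (.scale 7 (.var 1) (.var 1) (.var 1)) <|
  .seq (.assign 8 (.var 0)) (.scale 8 (.var 1) (.var 1) (.lit 15))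

/-- Membership of variable `u` in the current block. -/
def Expr.inBlock (u : ℕ) : Expr :=
  .and (.sub (.add (.var u) (.lit 1)) (.var 15)) (.sub (.add (.var 15) (.var 7)) (.var u))

/-- The expression for `Exploration.Usable`. -/
def Expr.usable (u v : ℕ) : Expr :=
  .and (.add (.inBlock u) (.and (.sub (.lit 1) (.var u)) (.inBlock v)))
    (.and (.get 1 (.var u)) (.and (.sub (.add (.var 10) (.lit 2)) (.get 1 (.var u)))
      (.sub (.lit 1) (.get 1 (.var v)))))

/-- Attaches the item in variable `v` to the one in variable `u` if this is allowed; `t` computes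
the new label, up to one subtraction of `k`. -/
def Prog.relax (k u v : ℕ) (t : Expr) : Prog :=
  .ite (.usable u v)
    (.seq (.assign 16 t) (.seq
      (.ite (.sub (.add (.var 16) (.lit 1)) (.lit k)) (.assign 16 (.sub (.var 16) (.lit k))) .skip)
      (.seq (.put 2 (.var v) (.var 16)) (.put 1 (.var v) (.add (.var 10) (.lit 2))))))
    .skip

/-- One query and its processing. -/
def Prog.visit (k : ℕ) : Prog :=
  .seq (.query 12 13 14) (.seq
    (.relax k 12 13 (.add (.get 2 (.var 12)) (.sub (.lit k) (.var 14))))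
    (.relax k 13 12 (.add (.get 2 (.var 13)) (.var 14))))

/-- The cell of array `3` that counts the votes for the label `e` of the item in variable `17`. -/
def Expr.cell (k : ℕ) (e : Expr) : Expr := .add (.mulLit k (.var 17)) e

/-- Counts the vote of the current tree for the item in variable `17`. -/
def Prog.vote (k : ℕ) : Prog :=
  .ite (.get 1 (.var 17))
    (.put 3 (.cell k (.get 2 (.var 17))) (.add (.get 3 (.cell k (.get 2 (.var 17)))) (.lit 1))) .skip

/-- Grows one search tree and counts its votes. -/
def Prog.tree (k : ℕ) : Prog :=
  .seq (.forN 17 (.var 0) (.put 1 (.var 17) (.lit 0))) <|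
  .seq (.put 1 (.lit 0) (.lit 1)) <| .seq (.put 2 (.lit 0) (.lit 0)) <|
  .seq (.forN 10 (.add (.var 1) (.var 1)) (.forN 11 (.var 8) (.visit k))) <|
  .seq (.forN 17 (.var 0) (.vote k)) (.assign 15 (.add (.var 15) (.var 7)))

/-- Gives the item in variable `17` a label with the most votes. -/
def Prog.decide (k : ℕ) : Prog :=
  .seq (.assign 19 (.lit 0)) (.seq
    (.forN 18 (.lit k) (.ite (.sub (.get 3 (.cell k (.var 18))) (.get 3 (.cell k (.var 19))))
      (.assign 19 (.var 18)) .skip))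
    (.put 0 (.var 17) (.var 19)))

/-- The clustering algorithm. -/
def clustering (k : ℕ) : Prog :=
  .seq .params <| .seq (.assign 15 (.lit 1)) <| .seq (.forN 9 (.var 6) (.tree k))
    (.forN 17 (.var 0) (.decide k))

/-! ### Verification of the program -/

section Verification

variable {m : ℕ} {resp : Fin m → ℕ × ℕ × ℕ}

/-- The parameters are stored in their variables. -/
structure Params (n : ℕ) (s : State) : Prop where
  items : s.var 0 = n
  level : s.var 1 = level n
  fan : s.var 6 = fan n
  block : s.var 7 = blockSize n
  round : s.var 8 = roundLength n

theorem Params.of_eq {n : ℕ} {s t : State} (h : Params n s)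
    (hst : ∀ u ∈ [0, 1, 6, 7, 8], t.var u = s.var u) : Params n t :=
  ⟨(hst 0 (by simp)).trans h.1, (hst 1 (by simp)).trans h.2, (hst 6 (by simp)).trans h.3,
    (hst 7 (by simp)).trans h.4, (hst 8 (by simp)).trans h.5⟩

/-- A bound for the running time of `Prog.scale` with bounds `a`, `b`, `c`. -/
def scaleTime (a b c : ℕ) : ℕ := a * (b * (c * 20 + 20) + 20) + 20

theorem triple_scale_time {v : ℕ} {a b c : Expr} {P Q : State → Prop} (A B C : ℕ)
    (hv : v ≠ 3 ∧ v ≠ 4 ∧ v ≠ 5) (hcost : a.cost ≤ 3 ∧ b.cost ≤ 3 ∧ c.cost ≤ 3)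
    (ha : ∀ s t, P s → SameExcept [3, 4, 5, v] s t → a.eval t = A)
    (hb : ∀ s t, P s → SameExcept [3, 4, 5, v] s t → b.eval t = B)
    (hc : ∀ s t, P s → SameExcept [3, 4, 5, v] s t → c.eval t = C)
    (hQ : ∀ s t, P s → SameExcept [3, 4, 5, v] s t → t.var v = s.var v * 2 ^ (A * B * C) → Q t) :
    Triple resp P (Prog.scale v a b c) Q (scaleTime A B C) := by
  intro s hs
  obtain ⟨t, T, h1, h2, h3, h4⟩ :=
    triple_scale (resp := resp) s A B C hv (ha s · hs) (hb s · hs) (hc s · hs) s rfl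
  refine ⟨t, T, h1, h2.trans ?_, hQ s t hs h3 h4⟩
  obtain ⟨h5, h6, h7⟩ := hcost
  calc _ ≤ A * ((B * ((C * (4 + 3 + 6) + 3 + 4) + 3 + 6) + 3 + 4) + 3 + 6) + 3 + 4 := by gcongr
    _ = A * (B * (C * 13 + 16) + 16) + 7 := by ring
    _ ≤ scaleTime A B C := by unfold scaleTime; gcongr <;> norm_num

/-- A bound for the running time of `Prog.params`. -/
def paramsTime (n w : ℕ) : ℕ :=
  n * (scaleTime n n (n + 1) + 40) + (2 * scaleTime w w w + scaleTime w w 1 + scaleTime w w 15) + 40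

theorem scaleTime_mono {a b c a' b' c' : ℕ} (ha : a ≤ a') (hb : b ≤ b') (hc : c ≤ c') :
    scaleTime a b c ≤ scaleTime a' b' c' := by
  unfold scaleTime; gcongr

theorem triple_params (n : ℕ) : Triple resp (fun s => s = State.init n) .params
    (fun s => Params n s ∧ s.asked = 0 ∧ s.arr = fun _ _ => 0) (paramsTime n (level n)) := by
  -- testing all levels up to `n` in turn computes `Nat.findGreatest`
  have hloop : Triple resp (fun s => s = State.init n)
      (.forN 20 (.var 0) (.seq (.assign 2 (.lit 2)) (.seq
      (.scale 2 (.add (.var 20) (.lit 1)) (.add (.var 20) (.lit 1)) (.add (.var 20) (.lit 2)))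
      (.ite (.sub (.var 0) (.var 2)) (.assign 1 (.add (.var 20) (.lit 1))) .skip))))
      (fun s => (s.var 0 = n ∧ s.var 1 = level n) ∧ s.asked = 0 ∧ s.arr = fun _ _ => 0)
      (n * (scaleTime n n (n + 1) + 40) + 5) := by
    refine (Triple.forN (resp := resp) (e := .var 0) (P := fun s => s = State.init n)
      (B := 2 + (scaleTime n n (n + 1) + 7)) (N := n)
      (fun i s => (s.var 0 = n ∧ s.var 1 = Nat.findGreatest (fun w => threshold w < n) i) ∧
        s.asked = 0 ∧ (s.arr = fun _ _ => 0) ∧ s.var 20 = i) ?_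
      (fun i s h => h.1.1) (fun i s h => h.2.2.2) (fun s h => ⟨h.1, h.2.1, h.2.2.1⟩)
      ?_).conseq (fun _ h => h) (fun _ h => h) ?_
    · rintro s rfl
      simp [State.init]
    · intro i hi
      refine Triple.seq (Q := fun s => ((s.var 0 = n ∧
        s.var 1 = Nat.findGreatest (fun w => threshold w < n) i) ∧
        s.asked = 0 ∧ (s.arr = fun _ _ => 0) ∧ s.var 20 = i) ∧ s.var 2 = 2)
        (Triple.assign ?_) (Triple.seq (Q := fun s => ((s.var 0 = n ∧
        s.var 1 = Nat.findGreatest (fun w => threshold w < n) i) ∧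
        s.asked = 0 ∧ (s.arr = fun _ _ => 0) ∧ s.var 20 = i) ∧ s.var 2 = threshold (i + 1))
        ((triple_scale_time (i + 1) (i + 1) (i + 2) (by simp) (by simp [Expr.cost])
          ?_ ?_ ?_ ?_).conseq (fun _ h => h) (fun _ h => h) ?_)
        (Triple.ite (B := 4) ((Triple.assign ?_).conseq (fun _ h => h) (fun _ h => h) ?_)
          ((Triple.skip ?_).conseq (fun _ h => h) (fun _ h => h) ?_)))
      · rintro s ⟨⟨h0, h1⟩, h2, h3, h4⟩
        simp [h0, h1, h2, h3, h4, Expr.eval]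
      · rintro s t ⟨⟨⟨h0, h1⟩, h2, h3, h4⟩, h5⟩ ⟨e1, e2, e3⟩
        simp [Expr.eval, e3, h4]
      · rintro s t ⟨⟨⟨h0, h1⟩, h2, h3, h4⟩, h5⟩ ⟨e1, e2, e3⟩
        simp [Expr.eval, e3, h4]
      · rintro s t ⟨⟨⟨h0, h1⟩, h2, h3, h4⟩, h5⟩ ⟨e1, e2, e3⟩
        simp [Expr.eval, e3, h4]
      · rintro s t ⟨⟨⟨h0, h1⟩, h2, h3, h4⟩, h5⟩ ⟨e1, e2, e3⟩ h6
        simp [e1, e2, e3, h0, h1, h2, h3, h4, h6, h5, threshold]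
      · exact scaleTime_mono (by omega) (by omega) (by omega)
      · rintro s ⟨⟨⟨⟨h0, h1⟩, h2, h3, h4⟩, h5⟩, h6⟩
        have h7 : threshold (i + 1) < n := by
          simp only [Expr.eval, h0, h5] at h6; omega
        simp [h0, h2, h3, h4, Expr.eval, h7]
      · simp [Expr.cost]
      · rintro s ⟨⟨⟨⟨h0, h1⟩, h2, h3, h4⟩, h5⟩, h6⟩
        have h7 : ¬ threshold (i + 1) < n := by
          simp only [Expr.eval, h0, h5] at h6; omega
        simp [h0, h1, h2, h3, h4, h7]
      · norm_num
    · simp only [Expr.cost]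
      have : n * (2 + (scaleTime n n (n + 1) + 7) + 1 + 6) ≤ n * (scaleTime n n (n + 1) + 40) :=
        Nat.mul_le_mul_left _ (by omega)
      omega
  refine (Triple.seq hloop <|
    Triple.seq (Q := fun s => ((s.var 0 = n ∧ s.var 1 = level n) ∧ s.var 6 = 1) ∧ s.asked = 0 ∧
      s.arr = fun _ _ => 0) (Triple.assign ?_) <|
    Triple.seq (Q := fun s => ((s.var 0 = n ∧ s.var 1 = level n) ∧ s.var 6 = fan n) ∧
      s.asked = 0 ∧ s.arr = fun _ _ => 0)
      (triple_scale_time (level n) (level n) 1 (by simp) (by simp [Expr.cost]) ?_ ?_ ?_ ?_) <|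
    Triple.seq (Q := fun s => ((s.var 0 = n ∧ s.var 1 = level n) ∧ s.var 6 = fan n ∧
      s.var 7 = 2) ∧ s.asked = 0 ∧ s.arr = fun _ _ => 0) (Triple.assign ?_) <|
    Triple.seq (Q := fun s => ((s.var 0 = n ∧ s.var 1 = level n) ∧ s.var 6 = fan n ∧
      s.var 7 = blockSize n) ∧ s.asked = 0 ∧ s.arr = fun _ _ => 0)
      (triple_scale_time (level n) (level n) (level n) (by simp) (by simp [Expr.cost])
        ?_ ?_ ?_ ?_) <|
    Triple.seq (Q := fun s => ((s.var 0 = n ∧ s.var 1 = level n) ∧ s.var 6 = fan n ∧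
      s.var 7 = blockSize n ∧ s.var 8 = n) ∧ s.asked = 0 ∧ s.arr = fun _ _ => 0)
      (Triple.assign ?_)
      (triple_scale_time (level n) (level n) 15 (by simp) (by simp [Expr.cost])
        ?_ ?_ ?_ ?_)).conseq (fun _ h => h) (fun _ h => h) ?_
  · rintro s ⟨⟨h0, h1⟩, h2, h3⟩
    simp [h0, h1, h2, h3, Expr.eval]
  · rintro s t ⟨⟨⟨h0, h1⟩, h4⟩, h2, h3⟩ ⟨e1, e2, e3⟩
    simp [Expr.eval, e3, h1]
  · rintro s t ⟨⟨⟨h0, h1⟩, h4⟩, h2, h3⟩ ⟨e1, e2, e3⟩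
    simp [Expr.eval, e3, h1]
  · rintro s t ⟨⟨⟨h0, h1⟩, h4⟩, h2, h3⟩ ⟨e1, e2, e3⟩
    simp [Expr.eval]
  · rintro s t ⟨⟨⟨h0, h1⟩, h4⟩, h2, h3⟩ ⟨e1, e2, e3⟩ h5
    simp [e1, e2, e3, h0, h1, h2, h3, h4, h5, fan]
  · rintro s ⟨⟨⟨h0, h1⟩, h4⟩, h2, h3⟩
    simp [h0, h1, h2, h3, h4, Expr.eval]
  · rintro s t ⟨⟨⟨h0, h1⟩, h4, h5⟩, h2, h3⟩ ⟨e1, e2, e3⟩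
    simp [Expr.eval, e3, h1]
  · rintro s t ⟨⟨⟨h0, h1⟩, h4, h5⟩, h2, h3⟩ ⟨e1, e2, e3⟩
    simp [Expr.eval, e3, h1]
  · rintro s t ⟨⟨⟨h0, h1⟩, h4, h5⟩, h2, h3⟩ ⟨e1, e2, e3⟩
    simp [Expr.eval, e3, h1]
  · rintro s t ⟨⟨⟨h0, h1⟩, h4, h5⟩, h2, h3⟩ ⟨e1, e2, e3⟩ h6
    simp [e1, e2, e3, h0, h1, h2, h3, h4, h5, h6, blockSize]
  · rintro s ⟨⟨⟨h0, h1⟩, h4, h5⟩, h2, h3⟩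
    simp [h0, h1, h2, h3, h4, h5, Expr.eval]
  · rintro s t ⟨⟨⟨h0, h1⟩, h4, h5, h6⟩, h2, h3⟩ ⟨e1, e2, e3⟩
    simp [Expr.eval, e3, h1]
  · rintro s t ⟨⟨⟨h0, h1⟩, h4, h5, h6⟩, h2, h3⟩ ⟨e1, e2, e3⟩
    simp [Expr.eval, e3, h1]
  · rintro s t ⟨⟨⟨h0, h1⟩, h4, h5, h6⟩, h2, h3⟩ ⟨e1, e2, e3⟩
    simp [Expr.eval]
  · rintro s t ⟨⟨⟨h0, h1⟩, h4, h5, h6⟩, h2, h3⟩ ⟨e1, e2, e3⟩ h7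
    exact ⟨⟨by simp [e3, h0], by simp [e3, h1], by simp [e3, h4], by simp [e3, h5],
      by simp [h7, h6, roundLength]⟩, by simp [e2, h2], by simp [e1, h3]⟩
  · simp only [Expr.cost, paramsTime]
    have : scaleTime (level n) (level n) (level n) ≤ 2 * scaleTime (level n) (level n) (level n) :=
      by omega
    omega

section Tree

variable {k : ℕ}

/-- Arrays `1` and `2` hold the search tree `T`, the labels being significant only for the items
that have been reached. -/
def Stores (n : ℕ) (T : Exploration (ZMod k)) (s : State) : Prop :=
  ∀ v < n, s.arr 1 v = T.stage v ∧ (T.stage v ≠ 0 → s.arr 2 v = (T.lab v).val)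

/-- The state between two trees: `cnt` holds the votes of the first `ρ` trees, and `a` queries have
been made. -/
structure Between (n ρ : ℕ) (cnt : ℕ → ℕ) (a : ℕ) (s : State) : Prop where
  params : Params n s
  index : s.var 9 = ρ
  start : s.var 15 = 1 + ρ * blockSize n
  votes : s.arr 3 = cnt
  asked : s.asked = a

theorem Between.of_eq {n ρ : ℕ} {cnt : ℕ → ℕ} {a : ℕ} {s t : State} (h : Between n ρ cnt a s)
    (hv : ∀ u ∈ [0, 1, 6, 7, 8, 9, 15], t.var u = s.var u)
    (harr : t.arr 3 = s.arr 3) (hasked : t.asked = s.asked) : Between n ρ cnt a t where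
  params := h.params.of_eq fun u hu => hv u (by simp at hu ⊢; tauto)
  index := (hv 9 (by simp)).trans h.index
  start := (hv 15 (by simp)).trans h.start
  votes := harr ▸ h.votes
  asked := hasked ▸ h.asked

theorem Between.setVar {n ρ : ℕ} {cnt : ℕ → ℕ} {a : ℕ} {s : State}
    (h : Between n ρ cnt a s) {u : ℕ} (hu : u ∉ [0, 1, 6, 7, 8, 9, 15]) (c : ℕ) :
    Between n ρ cnt a (s.setVar u c) :=
  h.of_eq (fun x hx => by
    have : x ≠ u := fun e => hu (e ▸ hx)
    simp [this]) rfl rfl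

/-- The state while tree number `ρ` is grown: the tree grown so far is `T`. -/
structure InTree (n ρ : ℕ) (cnt : ℕ → ℕ) (a : ℕ) (T : Exploration (ZMod k)) (s : State) : Prop
    extends Between n ρ cnt a s where
  stores : Stores n T s

theorem InTree.setVar {n ρ : ℕ} {cnt : ℕ → ℕ} {a : ℕ} {T : Exploration (ZMod k)} {s : State}
    (h : InTree n ρ cnt a T s) {u : ℕ} (hu : u ∉ [0, 1, 6, 7, 8, 9, 15]) (c : ℕ) :
    InTree n ρ cnt a T (s.setVar u c) :=
  ⟨h.toBetween.setVar hu c, h.stores⟩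

/-- The loop variables and the current query. -/
def Visiting (i τ x y r : ℕ) (s : State) : Prop :=
  s.var 10 = i ∧ s.var 11 = τ ∧ s.var 12 = x ∧ s.var 13 = y ∧ s.var 14 = r

theorem eval_inBlock_ne_zero {s : State} {u : ℕ} :
    (Expr.inBlock u).eval s ≠ 0 ↔ s.var 15 ≤ s.var u ∧ s.var u < s.var 15 + s.var 7 := by
  unfold Expr.inBlock
  rw [Expr.eval_and_ne_zero]
  simp only [Expr.eval]
  omega

theorem eval_usable_ne_zero {n ρ : ℕ} {cnt : ℕ → ℕ} {a : ℕ} {T : Exploration (ZMod k)} {s : State}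
    (h : InTree n ρ cnt a T s) {u v : ℕ} (hu : s.var u < n) (hv : s.var v < n) :
    (Expr.usable u v).eval s ≠ 0 ↔
      T.Usable (1 + ρ * blockSize n) (blockSize n) (s.var 10) (s.var u) (s.var v) := by
  have h1 := (h.stores _ hu).1
  have h2 := (h.stores _ hv).1
  have e1 : ∀ a b : Expr, (a.add b).eval s ≠ 0 ↔ a.eval s ≠ 0 ∨ b.eval s ≠ 0 := by
    intro a b; simp only [Expr.eval]; omega
  unfold Expr.usable Exploration.Usable
  rw [Expr.eval_and_ne_zero, Expr.eval_and_ne_zero, Expr.eval_and_ne_zero, e1,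
    Expr.eval_and_ne_zero, eval_inBlock_ne_zero, eval_inBlock_ne_zero]
  simp only [Expr.eval, h1, h2, h.start, h.params.block]
  have e2 : 1 - s.var u ≠ 0 ↔ s.var u = 0 := by omega
  have e3 : s.var 10 + 2 - T.stage (s.var u) ≠ 0 ↔ T.stage (s.var u) ≤ s.var 10 + 1 := by omega
  have e4 : 1 - T.stage (s.var v) ≠ 0 ↔ T.stage (s.var v) = 0 := by omega
  rw [e2, e3, e4]

/-- Reduction modulo `k` by at most one subtraction. -/
theorem val_natCast_of_lt {z : ℕ} (hz : z < 2 * k) :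
    (z : ZMod k).val = if k ≤ z then z - k else z := by
  rw [ZMod.val_natCast]
  split_ifs with h
  · rw [Nat.mod_eq_sub_mod h, Nat.mod_eq_of_lt (by omega)]
  · exact Nat.mod_eq_of_lt (by omega)

/-- `Prog.relax` carries out `Exploration.relax`; the expression `e` has to be right only if the item
`U` has been reached. -/
theorem triple_relax {n ρ : ℕ} {cnt : ℕ → ℕ} {a i τ x y r : ℕ} {T : Exploration (ZMod k)}
    {u v U V : ℕ} {e : Expr} {c : ZMod k} (hU : U < n) (hV : V < n)
    (hu : ∀ s, Visiting i τ x y r s → s.var u = U) (hv : ∀ s, Visiting i τ x y r s → s.var v = V)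
    (he : ∀ s, InTree n ρ cnt a T s → Visiting i τ x y r s → T.stage U ≠ 0 →
      e.eval s < 2 * k ∧ (e.eval s : ZMod k) = c) (hcost : e.cost ≤ 10) :
    Triple resp (fun s => InTree n ρ cnt a T s ∧ Visiting i τ x y r s) (.relax k u v e)
      (fun s => InTree n ρ cnt a (T.relax (1 + ρ * blockSize n) (blockSize n) i U V c) s ∧
        Visiting i τ x y r s) 120 := by
  let W := T.Usable (1 + ρ * blockSize n) (blockSize n) i U V
  have hvis : ∀ s z, Visiting i τ x y r s → Visiting i τ x y r (s.setVar 16 z) := by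
    rintro s z ⟨h1, h2, h3, h4, h5⟩
    exact ⟨by simp [h1], by simp [h2], by simp [h3], by simp [h4], by simp [h5]⟩
  have husable : ∀ s, InTree n ρ cnt a T s → Visiting i τ x y r s →
      ((Expr.usable u v).eval s ≠ 0 ↔ W) := by
    intro s h1 h2
    rw [eval_usable_ne_zero h1 (by rw [hu s h2]; exact hU) (by rw [hv s h2]; exact hV), h2.1,
      hu s h2, hv s h2]
  refine (Triple.ite (B := 40)
    ((Triple.seq (Q := fun s => ((InTree n ρ cnt a T s ∧ Visiting i τ x y r s) ∧ W) ∧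
        s.var 16 < 2 * k ∧ (s.var 16 : ZMod k) = c) (Triple.assign ?_) <|
      Triple.seq (Q := fun s => ((InTree n ρ cnt a T s ∧ Visiting i τ x y r s) ∧ W) ∧
        s.var 16 = c.val) (Triple.ite (B := 4) (Triple.assign ?_)
          ((Triple.skip ?_).conseq (fun _ h => h) (fun _ h => h) (by omega))) <|
      Triple.seq (Triple.put fun s hs => ?_) (Triple.put (P := fun s =>
        InTree n ρ cnt a (T.relax (1 + ρ * blockSize n) (blockSize n) i U V c)
          (s.setArr 1 ((Expr.var v).eval s) (((Expr.var 10).add (.lit 2)).eval s)) ∧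
        Visiting i τ x y r
          (s.setArr 1 ((Expr.var v).eval s) (((Expr.var 10).add (.lit 2)).eval s)))
        fun s hs => hs)).conseq (fun _ h => h) (fun _ h => h) ?_)
    ((Triple.skip ?_).conseq (fun _ h => h) (fun _ h => h) (by omega))).conseq
      (fun _ h => h) (fun _ h => h) ?_
  · rintro s ⟨⟨h1, h2⟩, h3⟩
    have hw := (husable s h1 h2).1 h3
    obtain ⟨h4, h5⟩ := he s h1 h2 hw.2.1
    exact ⟨⟨⟨h1.setVar (by simp) _, hvis _ _ h2⟩, hw⟩, by simpa using h4, by simpa using h5⟩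
  · rintro s ⟨⟨⟨⟨h1, h2⟩, hw⟩, h3, h4⟩, h5⟩
    refine ⟨⟨⟨h1.setVar (by simp) _, hvis _ _ h2⟩, hw⟩, ?_⟩
    simp only [Expr.eval] at h5
    rw [← h4, val_natCast_of_lt h3, if_pos (by omega)]
    simp [Expr.eval]
  · rintro s ⟨⟨⟨⟨h1, h2⟩, hw⟩, h3, h4⟩, h5⟩
    refine ⟨⟨⟨h1, h2⟩, hw⟩, ?_⟩
    simp only [Expr.eval] at h5
    rw [← h4, val_natCast_of_lt h3, if_neg (by omega)]
  · obtain ⟨⟨⟨h1, h2⟩, hw⟩, h3⟩ := hs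
    have hw' : T.Usable (1 + ρ * blockSize n) (blockSize n) i U V := hw
    simp only [Expr.eval, State.setArr_var, hv s h2, h2.1, h3]
    refine ⟨⟨h1.toBetween.of_eq (fun _ _ => rfl) (by simp) rfl, ?_⟩, h2⟩
    intro z hz
    have h4 := h1.stores z hz
    simp only [Exploration.relax, hw', if_true]
    by_cases hzV : z = V
    · subst hzV
      simp
    · simpa [Function.update_of_ne hzV] using h4
  · simp only [Expr.cost]; omega
  · rintro s ⟨⟨h1, h2⟩, h3⟩
    have hw : ¬ W := fun h => (husable s h1 h2).2 h h3
    simp only [Exploration.relax, if_neg (show ¬ T.Usable _ _ i U V from hw)]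
    exact ⟨h1, h2⟩
  · simp only [Expr.usable, Expr.inBlock, Expr.and, Expr.cost]; omega

/-- The queries `q` and the answers `r` are what the program is told. -/
def Answers (n : ℕ) (resp : Fin m → ℕ × ℕ × ℕ) (q : ℕ → ℕ × ℕ) (r : ℕ → ZMod k) : Prop :=
  ∀ j (h : j < m), resp ⟨j, h⟩ = ((q j).1, (q j).2, (r j).val) ∧ (q j).1 < n ∧ (q j).2 < n

variable {q : ℕ → ℕ × ℕ} {r : ℕ → ZMod k}

variable [NeZero k]

theorem triple_visit {n ρ : ℕ} {cnt : ℕ → ℕ} {a i τ : ℕ} {T : Exploration (ZMod k)}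
    (hans : Answers n resp q r) (ha : a < m) :
    Triple resp (fun s => InTree n ρ cnt a T s ∧ s.var 10 = i ∧ s.var 11 = τ) (.visit k)
      (fun s => InTree n ρ cnt (a + 1) (T.visit (1 + ρ * blockSize n) (blockSize n) i
        (q a).1 (q a).2 (r a)) s ∧ s.var 10 = i ∧ s.var 11 = τ) 250 := by
  obtain ⟨h1, h2, h3⟩ := hans a ha
  refine (Triple.seq (Q := fun s => InTree n ρ cnt (a + 1) T s ∧
      Visiting i τ (q a).1 (q a).2 (r a).val s) (Triple.query fun s hs => ?_) <|
    Triple.seq (triple_relax (U := (q a).1) (V := (q a).2) (c := T.lab (q a).1 - r a) h2 h3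
      (fun s hs => hs.2.2.1) (fun s hs => hs.2.2.2.1) ?_ (by simp [Expr.cost]))
    (triple_relax (U := (q a).2) (V := (q a).1) h3 h2
      (fun s hs => hs.2.2.2.1) (fun s hs => hs.2.2.1) ?_ (by simp [Expr.cost]))).conseq
      (fun _ h => h) (fun s hs => ⟨hs.1, hs.2.1, hs.2.2.1⟩) (by norm_num)
  · obtain ⟨hs, h4, h5⟩ := hs
    refine ⟨hs.asked.symm ▸ ha, ?_⟩
    simp only [hs.asked, h1]
    refine ⟨⟨⟨hs.params.of_eq ?_, ?_, ?_, hs.votes, rfl⟩, hs.stores⟩, ?_⟩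
    · simp
    · simpa using hs.index
    · simpa using hs.start
    · simp [Visiting, h4, h5]
  · rintro s hs ⟨-, -, h12, -, h14⟩ hst
    have h4 := (hs.stores _ h2).2 hst
    simp only [Expr.eval, h12, h14, h4]
    have h5 := ZMod.val_lt (T.lab (q a).1)
    have h6 := ZMod.val_lt (r a)
    refine ⟨by omega, ?_⟩
    rw [Nat.cast_add, Nat.cast_sub h6.le]
    simp [sub_eq_add_neg]
  · rintro s hs ⟨-, -, -, h13, h14⟩ hst
    have h4 := (hs.stores _ h3).2 hst
    simp only [Expr.eval, h13, h14, h4]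
    have h5 := ZMod.val_lt ((T.relax (1 + ρ * blockSize n) (blockSize n) i (q a).1 (q a).2
      (T.lab (q a).1 - r a)).lab (q a).2)
    have h6 := ZMod.val_lt (r a)
    refine ⟨by omega, ?_⟩
    rw [Nat.cast_add]
    simp

theorem triple_rounds {n ρ : ℕ} {cnt : ℕ → ℕ} (hans : Answers n resp q r)
    (hm : (ρ + 1) * ((level n + level n) * roundLength n) ≤ m) :
    Triple resp (fun s => InTree n ρ cnt (ρ * ((level n + level n) * roundLength n))
        (Exploration.root : Exploration (ZMod k)) s)
      (.forN 10 (.add (.var 1) (.var 1)) (.forN 11 (.var 8) (.visit k)))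
      (fun s => InTree n ρ cnt ((ρ + 1) * ((level n + level n) * roundLength n))
        (searchTree n q r ρ (level n + level n)) s)
      ((level n + level n) * (roundLength n * 257 + 14) + 7) := by
  set L := level n + level n
  set N := roundLength n
  refine (Triple.forN (N := L) (B := N * 257 + 5)
    (fun i s => InTree n ρ cnt (ρ * (L * N) + i * N) (searchTree n q r ρ i) s ∧ s.var 10 = i)
    ?_ (fun i s hs => ?_) (fun i s hs => hs.2) (fun s hs => ?_) ?_).conseq
      (fun _ h => h) (fun _ h => h) ?_
  · intro s hs
    refine ⟨?_, by simp⟩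
    simpa [searchTree, Exploration.grow] using hs.setVar (u := 10) (by simp) 0
  · simp [Expr.eval, hs.1.params.level, L]
  · rw [Nat.add_mul, Nat.one_mul]; exact hs.1
  · intro i hi
    refine (Triple.forN (e := .var 8) (N := N) (B := 250) (fun τ s => InTree n ρ cnt (ρ * (L * N) + i * N + τ)
      ((searchTree n q r ρ i).round (1 + ρ * blockSize n) (blockSize n) i
        (fun τ => q (ρ * (L * N) + (i * N + τ))) (fun τ => r (ρ * (L * N) + (i * N + τ))) τ) s ∧
      s.var 10 = i ∧ s.var 11 = τ) ?_ (fun τ s hs => hs.1.params.round)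
      (fun τ s hs => hs.2.2) (fun s hs => ?_) ?_).conseq (fun _ h => h) (fun _ h => h) ?_
    · rintro s ⟨hs, h10⟩
      exact ⟨hs.setVar (by simp) _, by simp [h10], by simp⟩
    · obtain ⟨h1, h2, h3⟩ := hs
      refine ⟨?_, by simp [h2]⟩
      rw [Nat.succ_mul, ← Nat.add_assoc]
      exact h1.setVar (by simp) _
    · intro τ hτ
      have hlt : ρ * (L * N) + i * N + τ < m := by
        have h1 : (i + 1) * N ≤ L * N := Nat.mul_le_mul_right _ hi
        rw [Nat.add_mul, Nat.one_mul] at h1 hm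
        omega
      refine (triple_visit hans hlt).conseq (fun s hs => hs) (fun s hs => ?_) le_rfl
      obtain ⟨h1, h2, h3⟩ := hs
      refine ⟨?_, by simp [h2], by simp [h3]⟩
      have h4 := h1.setVar (u := 11) (by simp) (s.var 11 + 1)
      rw [Exploration.round, ← Nat.add_assoc (ρ * (L * N))]
      exact h4
    · simp only [Expr.cost]
      omega
  · simp only [Expr.cost]
    have : L * (N * 257 + 5 + (1 + 1 + 1) + 6) = L * (N * 257 + 14) := by ring
    omega

end Tree

section Voting

variable {k : ℕ} [NeZero k] {q : ℕ → ℕ × ℕ} {r : ℕ → ZMod k}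

/-- The votes of the first `R` trees, as they are laid out in array `3`. -/
def Tally (n : ℕ) (q : ℕ → ℕ × ℕ) (r : ℕ → ZMod k) (R : ℕ) (cnt : ℕ → ℕ) : Prop :=
  ∀ x < n, ∀ c : ZMod k, cnt (x * k + c.val) = votes n q r R x c

omit [NeZero k] in
theorem votes_succ (n R x : ℕ) (c : ZMod k) : votes n q r (R + 1) x c = votes n q r R x c +
    if (searchTree n q r R (level n + level n)).stage x ≠ 0 ∧
      (searchTree n q r R (level n + level n)).lab x = c then 1 else 0 := by
  classical
  unfold votes
  rw [Finset.range_add_one, Finset.filter_insert]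
  split_ifs with h
  · rw [Finset.card_insert_of_notMem (by simp)]
  · simp

theorem cell_injective {x y : ℕ} {c d : ZMod k} (h : x * k + c.val = y * k + d.val) :
    x = y ∧ c = d := by
  have hk : 0 < k := Nat.pos_of_ne_zero (NeZero.ne k)
  have h1 : x = y := by
    have := congrArg (· / k) h
    simpa [Nat.mul_comm _ k, Nat.mul_add_div hk, Nat.div_eq_of_lt (ZMod.val_lt _)] using this
  subst h1
  exact ⟨rfl, ZMod.val_injective k (Nat.add_left_cancel h)⟩

omit [NeZero k] in
theorem eval_cell (s : State) (e : Expr) :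
    (Expr.cell k e).eval s = s.var 17 * k + e.eval s := by
  simp [Expr.cell, Expr.eval, Expr.eval_mulLit]

/-- The cost of addressing a cell of the votes. -/
def cellCost (k : ℕ) : ℕ := (Expr.mulLit k (.var 17)).cost

theorem triple_vote_loop {n ρ : ℕ} {cnt : ℕ → ℕ} {a : ℕ} (hcnt : Tally n q r ρ cnt) :
    Triple resp (InTree n ρ cnt a (searchTree n q r ρ (level n + level n)))
      (.forN 17 (.var 0) (.vote k))
      (fun s => ∃ cnt, Tally n q r (ρ + 1) cnt ∧ Between n ρ cnt a s)
      (n * (2 * cellCost k + 40) + 5) := by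
  set T := searchTree n q r ρ (level n + level n) with hT
  refine (Triple.forN (e := .var 0) (N := n) (B := 2 * cellCost k + 20)
    (fun i s => ∃ cnt, (∀ x < n, ∀ c : ZMod k,
      cnt (x * k + c.val) = votes n q r (if x < i then ρ + 1 else ρ) x c) ∧
      InTree n ρ cnt a T s ∧ s.var 17 = i) ?_ ?_ ?_ ?_ ?_).conseq
      (fun _ h => h) (fun _ h => h) ?_
  · intro s hs
    exact ⟨cnt, by simpa [Tally] using hcnt, hs.setVar (by simp) _, by simp⟩
  · rintro i s ⟨cnt, -, h1, h2⟩
    exact h1.params.items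
  · rintro i s ⟨cnt, -, h1, h2⟩
    exact h2
  · rintro s ⟨cnt, h0, h1, h2⟩
    refine ⟨cnt, fun x hx c => ?_, h1.toBetween⟩
    simpa [hx] using h0 x hx c
  · intro i hi
    have hsame : ∀ x c, x ≠ i →
        votes n q r (if x < i + 1 then ρ + 1 else ρ) x c =
          votes n q r (if x < i then ρ + 1 else ρ) x c := by
      intro x c hx
      have : x < i + 1 ↔ x < i := by omega
      simp [this]
    refine (Triple.ite (B := 2 * cellCost k + 15) ((Triple.put ?_).conseq (fun _ h => h)
      (fun _ h => h) ?_) ((Triple.skip ?_).conseq (fun _ h => h) (fun _ h => h) ?_)).conseq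
      (fun _ h => h) (fun _ h => h) ?_
    · rintro s ⟨⟨cnt, h0, h1, h2⟩, h3⟩
      have h4 := h1.stores i hi
      simp only [Expr.eval, h2, h4.1] at h3
      have h5 := h4.2 h3
      refine ⟨Function.update cnt (i * k + (T.lab i).val) (cnt (i * k + (T.lab i).val) + 1),
        fun x hx c => ?_, ?_, by simp [h2]⟩
      · by_cases hxi : x = i
        · subst hxi
          rw [if_pos (Nat.lt_succ_self x), votes_succ]
          have h6 := h0 x hx c
          rw [if_neg (lt_irrefl x)] at h6
          by_cases hc : T.lab x = c
          · subst hc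
            rw [if_pos ⟨h3, rfl⟩, Function.update_self, h6]
          · rw [if_neg fun h => hc h.2, Function.update_of_ne, h6, Nat.add_zero]
            exact fun h => hc (cell_injective h).2.symm
        · rw [Function.update_of_ne fun h => hxi (cell_injective h).1, hsame x c hxi, h0 x hx c]
      · refine InTree.setVar (s := s.setArr 3 _ _) ⟨⟨h1.params.of_eq fun u _ => rfl,
          h1.index, h1.start, ?_, h1.asked⟩, fun z hz => ?_⟩ (by simp) _
        · simp [eval_cell, Expr.eval, h2, h5, h1.votes]
        · simpa using h1.stores z hz
    · simp only [Expr.cost, Expr.cell, cellCost]; omega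
    · rintro s ⟨⟨cnt, h0, h1, h2⟩, h3⟩
      have h4 := h1.stores i hi
      simp only [Expr.eval, h2, h4.1] at h3
      refine ⟨cnt, fun x hx c => ?_, h1.setVar (by simp) _, by simp [h2]⟩
      by_cases hxi : x = i
      · subst hxi
        have h6 := h0 x hx c
        rw [if_neg (lt_irrefl x)] at h6
        rw [if_pos (Nat.lt_succ_self x), votes_succ, if_neg fun h => h.1 h3, h6, Nat.add_zero]
      · rw [hsame x c hxi, h0 x hx c]
    · omega
    · simp only [Expr.cost]; omega
  · simp only [Expr.cost]
    have : n * (2 * cellCost k + 20 + 1 + 6) ≤ n * (2 * cellCost k + 40) :=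
      Nat.mul_le_mul_left _ (by omega)
    omega

/-- A bound for the running time of `Prog.tree`, where `L` is the number of rounds and `N` their
length. -/
def treeTime (k n L N : ℕ) : ℕ :=
  n * 20 + (L * (N * 257 + 14) + n * (2 * cellCost k + 40)) + 50

theorem triple_tree {n ρ : ℕ} {cnt : ℕ → ℕ} (hans : Answers n resp q r)
    (hm : (ρ + 1) * ((level n + level n) * roundLength n) ≤ m) (hcnt : Tally n q r ρ cnt) :
    Triple resp (Between n ρ cnt (ρ * ((level n + level n) * roundLength n))) (.tree k)
      (fun s => ∃ cnt, Tally n q r (ρ + 1) cnt ∧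
        Between n (ρ + 1) cnt ((ρ + 1) * ((level n + level n) * roundLength n))
          (s.setVar 9 (s.var 9 + 1)))
      (treeTime k n (level n + level n) (roundLength n)) := by
  have hreset : Triple resp (Between n ρ cnt (ρ * ((level n + level n) * roundLength n)))
      (.forN 17 (.var 0) (.put 1 (.var 17) (.lit 0)))
      (fun s => Between n ρ cnt (ρ * ((level n + level n) * roundLength n)) s ∧
        ∀ x < n, s.arr 1 x = 0) (n * 20 + 5) := by
    refine (Triple.forN (e := .var 0) (N := n) (B := 3)
      (fun i s => Between n ρ cnt (ρ * ((level n + level n) * roundLength n)) s ∧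
        s.var 17 = i ∧ ∀ x < i, s.arr 1 x = 0) ?_ (fun i s h => h.1.params.items)
      (fun i s h => h.2.1) (fun s h => ⟨h.1, h.2.2⟩) ?_).conseq (fun _ h => h) (fun _ h => h) ?_
    · intro s hs
      exact ⟨hs.setVar (by simp) _, by simp, by simp⟩
    · intro i hi
      refine Triple.put ?_
      rintro s ⟨h1, h2, h3⟩
      refine ⟨(h1.of_eq (t := s.setArr 1 _ _) (fun _ _ => rfl) (by simp) rfl).setVar (by simp) _,
        by simp [h2], fun x hx => ?_⟩
      simp only [State.setVar_arr, State.setArr_arr, if_true, Expr.eval, h2,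
        Function.update_apply]
      split_ifs with h
      · rfl
      · exact h3 x (by omega)
    · simp only [Expr.cost]; omega
  refine (Triple.seq hreset <| Triple.seq (Q := fun s =>
      Between n ρ cnt (ρ * ((level n + level n) * roundLength n)) s ∧
        ∀ x < n, s.arr 1 x = if x = 0 then 1 else 0) (Triple.put ?_) <|
    Triple.seq (Triple.put ?_) <| Triple.seq (triple_rounds hans hm) <|
    Triple.seq (triple_vote_loop hcnt) (Triple.assign ?_)).conseq
      (fun _ h => h) (fun _ h => h) ?_
  · rintro s ⟨h1, h2⟩
    refine ⟨h1.of_eq (fun _ _ => rfl) (by simp) rfl, fun x hx => ?_⟩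
    simp only [State.setArr_arr, if_true, Expr.eval, Function.update_apply]
    split_ifs with h
    · rfl
    · exact h2 x hx
  · rintro s ⟨h1, h2⟩
    refine ⟨h1.of_eq (fun _ _ => rfl) (by simp) rfl,
      fun x hx => ⟨by simpa [Exploration.root] using h2 x hx, fun hx0 => ?_⟩⟩
    have : x = 0 := by
      by_contra h
      simp [Exploration.root, h] at hx0
    simp [Exploration.root, this, Expr.eval]
  · rintro s ⟨cnt, h1, h2⟩
    refine ⟨cnt, h1, h2.params.of_eq fun u hu => ?_, by simp [h2.index], ?_, h2.votes, h2.asked⟩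
    · have h9 : u ≠ 9 := by rintro rfl; simp at hu
      have h15 : u ≠ 15 := by rintro rfl; simp at hu
      simp [h9, h15]
    · simp [Expr.eval, h2.start, h2.params.block]
      ring
  · simp only [Expr.cost, treeTime]; omega

/-- `Prog.decide` writes a label with the most votes into the output and otherwise changes the
variables `18` and `19` only. -/
theorem triple_decide {x : ℕ} {cnt : ℕ → ℕ} {P : State → Prop}
    (hP : ∀ s, P s → s.var 17 = x ∧ s.arr 3 = cnt) :
    Triple resp P (.decide k)
      (fun t => ∃ s, P s ∧ ∃ (b : ZMod k) (c₁ c₂ : ℕ), (∀ c : ZMod k,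
        cnt (x * k + c.val) ≤ cnt (x * k + b.val)) ∧
        t = ((s.setVar 19 c₁).setVar 18 c₂).setArr 0 x b.val)
      (k * (2 * cellCost k + 40) + 20) := by
  intro s₀ hs₀
  obtain ⟨hx, hcnt⟩ := hP s₀ hs₀
  have h17 : ∀ c₁ c₂, ((s₀.setVar 19 c₁).setVar 18 c₂).var 17 = x := by simp [hx]
  have key : Triple resp (fun s => s = s₀) (.decide k) (fun t => ∃ (b : ZMod k) (c₁ c₂ : ℕ),
      (∀ c : ZMod k, cnt (x * k + c.val) ≤ cnt (x * k + b.val)) ∧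
        t = ((s₀.setVar 19 c₁).setVar 18 c₂).setArr 0 x b.val)
      (k * (2 * cellCost k + 40) + 20) := by
    have swap : ∀ c₁ c₂ c₃, (((s₀.setVar 19 c₁).setVar 18 c₂).setVar 19 c₃) =
        (s₀.setVar 19 c₃).setVar 18 c₂ := by
      intro c₁ c₂ c₃
      simp only [State.setVar, State.mk.injEq, and_true]
      funext u
      simp only [Function.update_apply]
      split_ifs <;> simp_all
    have twice : ∀ c₁ c₂ c₃, (((s₀.setVar 19 c₁).setVar 18 c₂).setVar 18 c₃) =
        (s₀.setVar 19 c₁).setVar 18 c₃ := by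
      intro c₁ c₂ c₃
      simp [State.setVar]
    refine (Triple.seq (Q := fun s => s = s₀.setVar 19 0) (Triple.assign ?_) <|
      Triple.seq (Q := fun s => ∃ b < k, s = (s₀.setVar 19 b).setVar 18 k ∧
        ∀ c < k, cnt (x * k + c) ≤ cnt (x * k + b))
      (Triple.forN (e := .lit k) (N := k) (B := 2 * cellCost k + 20)
        (fun i s => ∃ b < k, s = (s₀.setVar 19 b).setVar 18 i ∧
          ∀ c < i, cnt (x * k + c) ≤ cnt (x * k + b))
        ?_ (fun _ _ _ => rfl) ?_ (fun s h => h) ?_) (Triple.put ?_)).conseq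
        (fun _ h => h) (fun _ h => h) ?_
    · rintro s rfl; rfl
    · rintro s rfl
      exact ⟨0, Nat.pos_of_ne_zero (NeZero.ne k), rfl, by simp⟩
    · rintro i s ⟨b, -, rfl, -⟩
      simp
    · intro i hi
      refine (Triple.ite (B := 2) (Triple.assign ?_) ((Triple.skip ?_).conseq
        (fun _ h => h) (fun _ h => h) ?_)).conseq (fun _ h => h) (fun _ h => h) ?_
      · rintro s ⟨⟨b, hb, rfl, hc⟩, hlt⟩
        simp only [Expr.eval, eval_cell, h17, State.setVar_arr, hcnt, State.setVar_var] at hlt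
        refine ⟨i, hi, ?_, fun c hc' => ?_⟩
        · simp [Expr.eval, swap, twice]
        · simp only [if_true] at hlt
          rcases Nat.lt_succ_iff_lt_or_eq.1 hc' with h | h
          · have := hc c h
            simp at hlt
            omega
          · rw [h]
      · rintro s ⟨⟨b, hb, rfl, hc⟩, hlt⟩
        simp only [Expr.eval, eval_cell, h17, State.setVar_arr, hcnt, State.setVar_var] at hlt
        refine ⟨b, hb, ?_, fun c hc' => ?_⟩
        · simp [twice]
        · rcases Nat.lt_succ_iff_lt_or_eq.1 hc' with h | h
          · exact hc c h
          · simp at hlt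
            subst h
            omega
      · omega
      · simp only [Expr.cost, Expr.cell, cellCost]; omega
    · rintro s ⟨b, hb, rfl, hc⟩
      refine ⟨(b : ZMod k), b, k, fun c => ?_, ?_⟩
      · rw [ZMod.val_natCast_of_lt hb]
        exact hc _ (ZMod.val_lt c)
      · simp [Expr.eval, hx, ZMod.val_natCast_of_lt hb]
    · simp only [Expr.cost]
      have : k * (2 * cellCost k + 20 + 1 + 6) ≤ k * (2 * cellCost k + 40) :=
        Nat.mul_le_mul_left _ (by omega)
      omega
  obtain ⟨t, T, h1, h2, b, c₁, c₂, h3, h4⟩ := key s₀ rfl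
  exact ⟨t, T, h1, h2, s₀, hs₀, b, c₁, c₂, h3, h4⟩

/-- A bound for the running time of `clustering k`. -/
def runTime (k n w F N : ℕ) : ℕ :=
  paramsTime n w + F * (treeTime k n (w + w) N + 20) +
    n * (k * (2 * cellCost k + 40) + 40) + 40

/-- The program halts, and every item gets a label with the most votes. -/
theorem triple_clustering {n : ℕ} (hans : Answers n resp q r) (hm : queryCount n ≤ m) :
    Triple resp (fun s => s = State.init n) (clustering k)
      (fun t => ∀ x < n, ∃ b : ZMod k, t.arr 0 x = b.val ∧
        ∀ c, votes n q r (fan n) x c ≤ votes n q r (fan n) x b)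
      (runTime k n (level n) (fan n) (roundLength n)) := by
  set B := treeTime k n (level n + level n) (roundLength n)
  set D := k * (2 * cellCost k + 40) + 20
  have htrees : Triple resp (fun s => (Params n s ∧ s.asked = 0 ∧ s.arr = fun _ _ => 0) ∧
      s.var 15 = 1) (.forN 9 (.var 6) (.tree k))
      (fun s => ∃ cnt, Tally n q r (fan n) cnt ∧ s.var 0 = n ∧ s.arr 3 = cnt)
      (fan n * (B + 7) + 5) := by
    refine Triple.forN (e := .var 6) (N := fan n) (B := B) (fun ρ s => ∃ cnt,
      Tally n q r ρ cnt ∧ Between n ρ cnt (ρ * ((level n + level n) * roundLength n)) s) ?_ ?_ ?_ ?_ ?_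
    · rintro s ⟨⟨h1, h2, h3⟩, h4⟩
      refine ⟨fun _ => 0, fun x _ c => by simp [votes], h1.of_eq ?_, by simp, by simp [h4],
        by simp [h3], by simp [h2]⟩
      simp
    · rintro i s ⟨cnt, h1, h2⟩
      exact h2.params.fan
    · rintro i s ⟨cnt, h1, h2⟩
      exact h2.index
    · rintro s ⟨cnt, h1, h2⟩
      exact ⟨cnt, h1, h2.params.items, h2.votes⟩
    · rintro ρ hρ s ⟨cnt, h1, h2⟩
      exact triple_tree hans ((Nat.mul_le_mul_right _ hρ).trans hm) h1 s h2
  have hdecide : Triple resp (fun s => ∃ cnt, Tally n q r (fan n) cnt ∧ s.var 0 = n ∧ s.arr 3 = cnt)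
      (.forN 17 (.var 0) (.decide k)) (fun t => ∀ x < n, ∃ b : ZMod k, t.arr 0 x = b.val ∧
        ∀ c, votes n q r (fan n) x c ≤ votes n q r (fan n) x b) (n * (D + 7) + 5) := by
    rintro s₀ ⟨cnt, h1, h2, h3⟩
    refine Triple.forN (P := fun s => s = s₀) (e := .var 0) (N := n) (B := D)
      (fun i s => s.var 0 = n ∧ s.var 17 = i ∧ s.arr 3 = cnt ∧ ∀ x < i,
        ∃ b : ZMod k, s.arr 0 x = b.val ∧
          ∀ c, votes n q r (fan n) x c ≤ votes n q r (fan n) x b)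
      ?_ (fun i s h => h.1) (fun i s h => h.2.1) (fun s h => h.2.2.2) ?_ s₀ rfl
    · rintro s rfl
      simp [h2, h3]
    · intro i hi
      refine (triple_decide (x := i) (cnt := cnt)
        fun s h => ⟨h.2.1, h.2.2.1⟩).conseq (fun _ h => h) ?_ le_rfl
      rintro t ⟨s, ⟨e1, e2, e3, e4⟩, b, c₁, c₂, hb, rfl⟩
      refine ⟨by simp [e1], by simp [e2], by simp [e3], fun x hx => ?_⟩
      simp only [State.setVar_arr, State.setArr_arr, if_true, Function.update_apply]
      split_ifs with h
      · subst h
        refine ⟨b, rfl, fun c => ?_⟩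
        rw [← h1 x hi, ← h1 x hi]
        exact hb c
      · exact e4 x (by omega)
  refine (Triple.seq (triple_params n) <| Triple.seq (Triple.assign ?_) <|
    Triple.seq htrees hdecide).conseq (fun _ h => h) (fun _ h => h) ?_
  · rintro s ⟨h1, h2, h3⟩
    refine ⟨⟨h1.of_eq ?_, h2, h3⟩, by simp [Expr.eval]⟩
    simp
  · have h1 : fan n * (B + 7) ≤ fan n * (B + 20) := Nat.mul_le_mul_left _ (by omega)
    have h2 : n * (D + 7) ≤ n * (k * (2 * cellCost k + 40) + 40) :=
      Nat.mul_le_mul_left _ (by omega)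
    have h3 : runTime k n (level n) (fan n) (roundLength n) = paramsTime n (level n) +
        fan n * (B + 20) + n * (k * (2 * cellCost k + 40) + 40) + 40 := rfl
    simp only [Expr.cost, h3]
    omega

end Voting
end Verification

namespace Exploration

/-! ### Properties of search trees -/

section Map

variable {A A' : Type*} [AddGroup A] [AddGroup A']

/-- Applies a homomorphism to all labels. -/
def map (φ : A →+ A') (T : Exploration A) : Exploration A' := ⟨T.stage, fun v => φ (T.lab v)⟩

theorem map_relax (φ : A →+ A') (lo s i u v : ℕ) (a : A) (T : Exploration A) :
    (T.map φ).relax lo s i u v (φ a) = (T.relax lo s i u v a).map φ := by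
  have h : (T.map φ).Usable lo s i u v ↔ T.Usable lo s i u v := Iff.rfl
  unfold relax
  by_cases hu : T.Usable lo s i u v
  · rw [if_pos hu, if_pos (h.2 hu)]
    simp only [map, Exploration.mk.injEq, true_and]
    funext w
    simp only [Function.update_apply]
    split_ifs <;> rfl
  · rw [if_neg hu, if_neg (h.not.2 hu)]

theorem map_visit (φ : A →+ A') (lo s i x y : ℕ) (r : A) (T : Exploration A) :
    (T.map φ).visit lo s i x y (φ r) = (T.visit lo s i x y r).map φ := by
  have h1 : (T.map φ).lab x - φ r = φ (T.lab x - r) := by simp [map]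
  have h2 : ∀ T : Exploration A, (T.map φ).lab y + φ r = φ (T.lab y + r) := by simp [map]
  simp only [visit, h1, h2, map_relax]

theorem map_round (φ : A →+ A') (lo s i : ℕ) (q : ℕ → ℕ × ℕ) (r : ℕ → A) (τ : ℕ)
    (T : Exploration A) :
    (T.map φ).round lo s i q (fun j => φ (r j)) τ = (T.round lo s i q r τ).map φ := by
  induction τ with
  | zero => rfl
  | succ τ ih => simp only [round, ih, map_visit]

theorem map_grow (φ : A →+ A') (lo s Q : ℕ) (q : ℕ → ℕ × ℕ) (r : ℕ → A) (i : ℕ) :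
    grow lo s Q q (fun j => φ (r j)) i = (grow lo s Q q r i).map φ := by
  induction i with
  | zero => simp [grow, root, map]
  | succ i ih => simp only [grow, ih, map_round φ]

end Map

section Stage

variable {A : Type*} {lo s i : ℕ}

theorem relax_stage_eq {u v w : ℕ} {a : A} {T : Exploration A} (h : T.stage w ≠ 0) :
    (T.relax lo s i u v a).stage w = T.stage w := by
  unfold relax
  split_ifs with hu
  · refine Function.update_of_ne ?_ _ _
    rintro rfl
    exact h hu.2.2.2
  · rfl

theorem relax_stage_le {u v w : ℕ} {a : A} {T : Exploration A} (h : ∀ w, T.stage w ≤ i + 2) :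
    (T.relax lo s i u v a).stage w ≤ i + 2 := by
  unfold relax
  split_ifs with hu
  · simp only [Function.update_apply]
    split_ifs
    exacts [le_rfl, h w]
  · exact h w

theorem relax_stage_ne_zero {u v : ℕ} {a : A} {T : Exploration A}
    (hB : (lo ≤ u ∧ u < lo + s) ∨ (u = 0 ∧ lo ≤ v ∧ v < lo + s))
    (h0 : T.stage u ≠ 0) (h1 : T.stage u ≤ i + 1) : (T.relax lo s i u v a).stage v ≠ 0 := by
  by_cases hv : T.stage v = 0
  · rw [relax, if_pos ⟨hB, h0, h1, hv⟩]; simp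
  · rw [relax_stage_eq hv]; exact hv

variable [AddGroup A]

theorem visit_stage_eq {x y w : ℕ} {r : A} {T : Exploration A} (h : T.stage w ≠ 0) :
    (T.visit lo s i x y r).stage w = T.stage w := by
  have h1 := relax_stage_eq (lo := lo) (s := s) (i := i) (u := x) (v := y) (a := T.lab x - r) h
  simp only [visit]
  rw [relax_stage_eq (by rw [h1]; exact h), h1]

theorem round_stage_eq {q : ℕ → ℕ × ℕ} {r : ℕ → A} {w : ℕ} {T : Exploration A}
    (h : T.stage w ≠ 0) (τ : ℕ) : (T.round lo s i q r τ).stage w = T.stage w := by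
  induction τ with
  | zero => rfl
  | succ τ ih => rw [round, visit_stage_eq (by rw [ih]; exact h), ih]

theorem round_stage_le {q : ℕ → ℕ × ℕ} {r : ℕ → A} {T : Exploration A}
    (h : ∀ w, T.stage w ≤ i + 2) (τ w : ℕ) : (T.round lo s i q r τ).stage w ≤ i + 2 := by
  induction τ generalizing w with
  | zero => exact h w
  | succ τ ih => exact relax_stage_le fun w => relax_stage_le ih

theorem grow_stage_le {Q : ℕ} {q : ℕ → ℕ × ℕ} {r : ℕ → A} (i w : ℕ) :
    (grow lo s Q q r i).stage w ≤ i + 1 := by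
  induction i generalizing w with
  | zero => simp only [grow, root]; split_ifs <;> simp
  | succ i ih => exact round_stage_le (fun w => (ih w).trans (by omega)) _ _

theorem grow_stage_ne_zero_succ {Q : ℕ} {q : ℕ → ℕ × ℕ} {r : ℕ → A} {i w : ℕ}
    (h : (grow lo s Q q r i).stage w ≠ 0) : (grow lo s Q q r (i + 1)).stage w ≠ 0 := by
  rw [grow, round_stage_eq h]; exact h

/-- A query between an item `u` of the tree and an item `v` extends the tree to `v`. -/
theorem grow_stage_ne_zero_of_query {Q : ℕ} {q : ℕ → ℕ × ℕ} {r : ℕ → A} {i u v τ : ℕ}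
    (hB : (lo ≤ u ∧ u < lo + s) ∨ (u = 0 ∧ lo ≤ v ∧ v < lo + s))
    (hu : (grow lo s Q q r i).stage u ≠ 0) (hτ : τ < Q)
    (hq : q (i * Q + τ) = (u, v) ∨ q (i * Q + τ) = (v, u)) :
    (grow lo s Q q r (i + 1)).stage v ≠ 0 := by
  set T := grow lo s Q q r i
  have hle : T.stage u ≤ i + 1 := grow_stage_le i u
  have hlast : ∀ d, (T.round lo s i (fun τ => q (i * Q + τ)) (fun τ => r (i * Q + τ))
      (τ + 1 + d)).stage v ≠ 0 := by
    intro d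
    induction d with
    | zero =>
      have h0 := round_stage_eq (lo := lo) (s := s) (i := i) (q := fun τ => q (i * Q + τ))
        (r := fun τ => r (i * Q + τ)) hu τ
      simp only [round, visit]
      rcases hq with hq | hq
      · rw [hq]
        have h1 := relax_stage_ne_zero (a := (T.round lo s i (fun τ => q (i * Q + τ))
          (fun τ => r (i * Q + τ)) τ).lab u - r (i * Q + τ)) hB (by rw [h0]; exact hu)
          (by rw [h0]; exact hle)
        rw [relax_stage_eq h1]; exact h1
      · rw [hq]
        have h2 := relax_stage_eq (lo := lo) (s := s) (i := i) (u := v) (v := u)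
          (a := (T.round lo s i (fun τ => q (i * Q + τ))
          (fun τ => r (i * Q + τ)) τ).lab v - r (i * Q + τ)) (w := u)
          (T := T.round lo s i (fun τ => q (i * Q + τ)) (fun τ => r (i * Q + τ)) τ)
          (by rw [h0]; exact hu)
        exact relax_stage_ne_zero hB (by rw [h2, h0]; exact hu) (by rw [h2, h0]; exact hle)
    | succ d ih => rw [← Nat.add_assoc, round, visit_stage_eq ih]; exact ih
  have := hlast (Q - (τ + 1))
  rwa [Nat.add_sub_cancel' hτ] at this

end Stage

end Exploration

/-! ### Symbolic labels -/

section Symbolic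

variable {n : ℕ}

/-- The pair `p` has one item in the block `[lo, lo + s)` and the other one in the block or equal to
the root `0` or to `v`. -/
def Touches (lo s v : ℕ) (p : Pair n) : Prop :=
  ((lo ≤ (p.1.1 : ℕ) ∧ (p.1.1 : ℕ) < lo + s) ∧
    ((lo ≤ (p.1.2 : ℕ) ∧ (p.1.2 : ℕ) < lo + s) ∨ (p.1.2 : ℕ) = 0 ∨ (p.1.2 : ℕ) = v)) ∨
  ((lo ≤ (p.1.2 : ℕ) ∧ (p.1.2 : ℕ) < lo + s) ∧
    ((lo ≤ (p.1.1 : ℕ) ∧ (p.1.1 : ℕ) < lo + s) ∨ (p.1.1 : ℕ) = 0 ∨ (p.1.1 : ℕ) = v))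

/-- Trees with disjoint blocks that do not contain the root use different pairs on their paths to the
same item. -/
theorem not_touches_of_touches {lo lo' s x : ℕ} {p : Pair n} (hlo : 0 < lo) (hlo' : 0 < lo')
    (hdisj : lo + s ≤ lo' ∨ lo' + s ≤ lo) (h : Touches lo s x p) : ¬ Touches lo' s x p := by
  have hp : (p.1.1 : ℕ) < p.1.2 := p.2
  unfold Touches at *
  omega

/-- The value of a formal combination of pairs under `h`. -/
def evalPairs {k : ℕ} (h : Pair n → ZMod k) : (Pair n → ℤ) →+ ZMod k where
  toFun c := ∑ p, c p • h p
  map_zero' := by simp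
  map_add' c d := by simp [add_smul, Finset.sum_add_distrib]

theorem evalPairs_single {k : ℕ} (h : Pair n → ZMod k) (p : Pair n) :
    evalPairs h (Pi.single p 1) = h p := by
  simp [evalPairs, Pi.single_apply]

/-- What is known about the labels of a search tree whose answers are formal symbols: the label of
`v` is a signed sum of the pairs along a path from the root to `v`, which has at most `stage v - 1`
pairs, all of them different, within the tree, and close to the block. -/
structure Symbolic {k : ℕ} (lo s : ℕ) (g : ℕ → ZMod k) (T : Exploration (Pair n → ℤ)) : Prop where
  coeff : ∀ v, T.stage v ≠ 0 → ∀ p, T.lab v p ≠ 0 → T.lab v p = 1 ∨ T.lab v p = -1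
  touches : ∀ v, T.stage v ≠ 0 → ∀ p, T.lab v p ≠ 0 → Touches lo s v p
  inside : ∀ v, T.stage v ≠ 0 → ∀ p, T.lab v p ≠ 0 → T.stage p.1.1 ≠ 0 ∧ T.stage p.1.2 ≠ 0
  length : ∀ v, T.stage v ≠ 0 → (Finset.univ.filter fun p => T.lab v p ≠ 0).card + 1 ≤ T.stage v
  potential : ∀ v, T.stage v ≠ 0 →
    evalPairs (fun p : Pair n => g p.1.1 - g p.1.2) (T.lab v) = g v - g 0

/-- Attaching `v` to `u` adds the pair of `u` and `v` to the label, which is new because `v` was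
outside the tree. -/
theorem Symbolic.relax {k lo s i u v : ℕ} {g : ℕ → ZMod k} {T : Exploration (Pair n → ℤ)}
    (hT : Symbolic lo s g T) (p : Pair n) (σ : ℤ) (hσ : σ = 1 ∨ σ = -1)
    (hp : ((p.1.1 : ℕ) = u ∧ (p.1.2 : ℕ) = v) ∨ ((p.1.1 : ℕ) = v ∧ (p.1.2 : ℕ) = u))
    (hg : σ • (g p.1.1 - g p.1.2) = g v - g u) :
    Symbolic lo s g (T.relax lo s i u v (T.lab u + σ • Pi.single p 1)) := by
  by_cases hU : T.Usable lo s i u v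
  swap
  · rw [Exploration.relax, if_neg hU]; exact hT
  rw [Exploration.relax, if_pos hU]
  obtain ⟨hB, hu0, hui, hv0⟩ := hU
  have huv : u ≠ v := by rintro rfl; exact hu0 hv0
  have hup : T.lab u p = 0 := by
    by_contra h
    have := hT.inside u hu0 p h
    rcases hp with ⟨h1, h2⟩ | ⟨h1, h2⟩
    · exact this.2 (by rw [h2]; exact hv0)
    · exact this.1 (by rw [h1]; exact hv0)
  have hstage : ∀ w, T.stage w ≠ 0 → Function.update T.stage v (i + 2) w ≠ 0 := by
    intro w hw
    rw [Function.update_apply]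
    split_ifs <;> simp [hw]
  have hnew : ∀ p', p' ≠ p → (T.lab u + σ • Pi.single p 1 : Pair n → ℤ) p' = T.lab u p' := by
    intro p' hp'
    simp [hp']
  have hnewp : (T.lab u + σ • Pi.single p 1 : Pair n → ℤ) p = σ := by simp [hup]
  have hpu : T.stage u ≠ 0 → Function.update T.stage v (i + 2) p.1.1 ≠ 0 ∧
      Function.update T.stage v (i + 2) p.1.2 ≠ 0 := by
    intro h
    rcases hp with ⟨h1, h2⟩ | ⟨h1, h2⟩ <;> rw [h1, h2] <;> simp [hu0, huv]
  constructor
  · intro w hw p' hp'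
    by_cases hwv : w = v
    · subst hwv
      simp only [Function.update_self] at hp' ⊢
      by_cases h : p' = p
      · subst h; rw [hnewp]; exact hσ
      · rw [hnew p' h] at hp' ⊢; exact hT.coeff u hu0 p' hp'
    · simp only [Function.update_of_ne hwv] at hw hp' ⊢
      exact hT.coeff w hw p' hp'
  · intro w hw p' hp'
    by_cases hwv : w = v
    · subst hwv
      simp only [Function.update_self] at hp'
      by_cases h : p' = p
      · subst h
        unfold Touches
        omega
      · rw [hnew p' h] at hp'
        have := hT.touches u hu0 p' hp'
        unfold Touches at *
        omega
    · simp only [Function.update_of_ne hwv] at hw hp'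
      exact hT.touches w hw p' hp'
  · intro w hw p' hp'
    by_cases hwv : w = v
    · subst hwv
      simp only [Function.update_self] at hp'
      by_cases h : p' = p
      · subst h
        exact hpu hu0
      · rw [hnew p' h] at hp'
        have := hT.inside u hu0 p' hp'
        exact ⟨hstage _ this.1, hstage _ this.2⟩
    · simp only [Function.update_of_ne hwv] at hw hp'
      have := hT.inside w hw p' hp'
      exact ⟨hstage _ this.1, hstage _ this.2⟩
  · intro w hw
    by_cases hwv : w = v
    · subst hwv
      simp only [Function.update_self]
      have h1 := hT.length u hu0
      have h2 : (Finset.univ.filter fun p' => (T.lab u + σ • Pi.single p 1 : Pair n → ℤ) p' ≠ 0) ⊆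
          insert p (Finset.univ.filter fun p' => T.lab u p' ≠ 0) := by
        intro p' hp'
        rw [Finset.mem_filter] at hp'
        rw [Finset.mem_insert, Finset.mem_filter]
        by_cases h : p' = p
        · exact Or.inl h
        · rw [hnew p' h] at hp'; exact Or.inr hp'
      have h3 := (Finset.card_le_card h2).trans (Finset.card_insert_le _ _)
      omega
    · simp only [Function.update_of_ne hwv] at hw ⊢
      exact hT.length w hw
  · intro w hw
    by_cases hwv : w = v
    · subst hwv
      simp only [Function.update_self]
      rw [map_add, map_zsmul, evalPairs_single, hT.potential u hu0, hg]
      ring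
    · simp only [Function.update_of_ne hwv] at hw ⊢
      exact hT.potential w hw

theorem symbolic_grow {k : ℕ} (lo s Q : ℕ) (g : ℕ → ZMod k) (e : ℕ → Pair n) (i : ℕ) :
    Symbolic lo s g (Exploration.grow lo s Q (fun j => (((e j).1.1 : ℕ), ((e j).1.2 : ℕ)))
      (fun j => (Pi.single (e j) 1 : Pair n → ℤ)) i) := by
  induction i with
  | zero =>
    constructor
    · simp [Exploration.grow, Exploration.root]
    · simp [Exploration.grow, Exploration.root]
    · simp [Exploration.grow, Exploration.root]
    · intro v hv
      simpa [Exploration.grow, Exploration.root, Nat.one_le_iff_ne_zero] using hv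
    · intro v hv
      have : v = 0 := by
        by_contra h
        simp [Exploration.grow, Exploration.root, h] at hv
      simp [Exploration.grow, Exploration.root, this]
  | succ i ih =>
    rw [Exploration.grow]
    generalize Exploration.grow lo s Q (fun j => (((e j).1.1 : ℕ), ((e j).1.2 : ℕ)))
      (fun j => (Pi.single (e j) 1 : Pair n → ℤ)) i = T at ih
    have : ∀ τ, Symbolic lo s g (T.round lo s i
        (fun τ => (((e (i * Q + τ)).1.1 : ℕ), ((e (i * Q + τ)).1.2 : ℕ)))
        (fun τ => (Pi.single (e (i * Q + τ)) 1 : Pair n → ℤ)) τ) := by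
      intro τ
      induction τ with
      | zero => exact ih
      | succ τ ihτ =>
        rw [Exploration.round]
        have h1 := ihτ.relax (i := i) (e (i * Q + τ)) (-1) (Or.inr rfl) (Or.inl ⟨rfl, rfl⟩)
          (by simp)
        have h2 := h1.relax (i := i) (e (i * Q + τ)) 1 (Or.inl rfl) (Or.inr ⟨rfl, rfl⟩)
          (by simp)
        rw [one_smul, neg_one_zsmul, ← sub_eq_add_neg] at h2
        exact h2
    exact this Q

end Symbolic

/-! ### Expansion -/

section Expansion

variable {n : ℕ}

/-- The pair `p` consists of `u` and `v`. -/
def Joins (p : Pair n) (u v : Fin n) : Prop := p.1 = (u, v) ∨ p.1 = (v, u)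

instance (p : Pair n) (u v : Fin n) : Decidable (Joins p u v) :=
  inferInstanceAs (Decidable (_ ∨ _))

/-- The items of the block `[lo, lo + s)`. -/
def block (n lo s : ℕ) : Finset (Fin n) := Finset.univ.filter fun v => lo ≤ (v : ℕ) ∧ (v : ℕ) < lo + s

theorem mem_block {lo s : ℕ} {v : Fin n} : v ∈ block n lo s ↔ lo ≤ (v : ℕ) ∧ (v : ℕ) < lo + s := by
  simp [block]

theorem card_block {lo s : ℕ} (h : lo + s ≤ n) : (block n lo s).card = s := by
  have : (block n lo s).map Fin.valEmbedding = Finset.Ico lo (lo + s) := by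
    ext v
    simp only [Finset.mem_map, mem_block, Fin.valEmbedding_apply, Finset.mem_Ico]
    constructor
    · rintro ⟨u, hu, rfl⟩; exact hu
    · intro hv; exact ⟨⟨v, by omega⟩, hv, rfl⟩
  rw [← Finset.card_map, this, Nat.card_Ico]
  omega

/-- Every set of `G ^ j` items, `j < w`, has more than `G ^ (j + 1)` neighbours in the block, itself
included, with respect to the `Q` pairs `e`. -/
def Expanding (n lo s G w Q : ℕ) (e : ℕ → Pair n) : Prop :=
  ∀ j < w, ∀ S T : Finset (Fin n), S.card = G ^ j → T.card = G ^ (j + 1) → S ∩ block n lo s ⊆ T →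
    ∃ τ < Q, ∃ u ∈ S, ∃ v ∈ block n lo s \ T, Joins (e τ) u v

/-- A set `T` that contains all neighbours of `S` in the block is large. -/
theorem Expanding.lt_card {lo s G w Q j : ℕ} {e : ℕ → Pair n} (h : Expanding n lo s G w Q e)
    (hG : 0 < G) (hn : G ^ w ≤ n) (hj : j < w) {S T : Finset (Fin n)} (hS : G ^ j ≤ S.card)
    (hST : S ∩ block n lo s ⊆ T)
    (hno : ∀ τ < Q, ∀ u ∈ S, ∀ v ∈ block n lo s, Joins (e τ) u v → v ∈ T) :
    G ^ (j + 1) < T.card := by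
  by_contra! hT
  obtain ⟨S', hS', hS'c⟩ := Finset.exists_subset_card_eq hS
  have hle : G ^ (j + 1) ≤ (Finset.univ : Finset (Fin n)).card := by
    rw [Finset.card_univ, Fintype.card_fin]
    exact (Nat.pow_le_pow_right hG hj).trans hn
  obtain ⟨T', hTT', -, hT'⟩ := Finset.exists_subsuperset_card_eq (Finset.subset_univ T) hT hle
  obtain ⟨τ, hτ, u, hu, v, hv, hJ⟩ := h j hj S' T' hS'c hT'
    ((Finset.inter_subset_inter_right hS').trans (hST.trans hTT'))
  rw [Finset.mem_sdiff] at hv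
  exact hv.2 (hTT' (hno τ hτ u (hS' hu) v hv.1 hJ))

variable {A : Type*} [AddGroup A]

/-- If all rounds expand, then the tree reaches all items: the tree grown in the first half of the
rounds covers more than half of the block, and so does the set of those items of the block from
which an item would be reached in the second half of the rounds. -/
theorem Exploration.grow_stage_ne_zero_of_expanding {lo s G w Q : ℕ} {e : ℕ → Pair n} {r : ℕ → A}
    (hlo : 0 < lo) (hlos : lo + s ≤ n) (hG : 0 < G) (hw : 0 < w) (hs : s = 2 * G ^ w)
    (hexp : ∀ i < w + w, Expanding n lo s G w Q fun τ => e (i * Q + τ)) (x : Fin n) :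
    (grow lo s Q (fun j => (((e j).1.1 : ℕ), ((e j).1.2 : ℕ))) r (w + w)).stage x ≠ 0 := by
  intro hx
  set T := grow lo s Q (fun j => (((e j).1.1 : ℕ), ((e j).1.2 : ℕ))) r with hT
  have hGn : G ^ w ≤ n := by omega
  have hstep : ∀ i τ (u v : Fin n), τ < Q → Joins (e (i * Q + τ)) u v →
      (u ∈ block n lo s ∨ ((u : ℕ) = 0 ∧ v ∈ block n lo s)) → (T i).stage u ≠ 0 →
      (T (i + 1)).stage v ≠ 0 := by
    intro i τ u v hτ hJ hB hu
    refine grow_stage_ne_zero_of_query ?_ hu hτ ?_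
    · rwa [mem_block, mem_block] at hB
    · rcases hJ with hJ | hJ <;> rw [hJ] <;> simp
  have hmono : ∀ i v, (T i).stage v ≠ 0 → (T (i + 1)).stage v ≠ 0 :=
    fun i v h => grow_stage_ne_zero_succ h
  -- growth from the root
  have hfwd : ∀ i < w, G ^ i ≤ (Finset.univ.filter fun v : Fin n => (T i).stage v ≠ 0 ∧
      (v ∈ block n lo s ∨ (v : ℕ) = 0)).card → G ^ (i + 1) <
      ((block n lo s).filter fun v : Fin n => (T (i + 1)).stage v ≠ 0).card := by
    intro i hi hcard
    refine (hexp i (by omega)).lt_card hG hGn hi hcard ?_ ?_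
    · intro v hv
      simp only [Finset.mem_inter, Finset.mem_filter, Finset.mem_univ, true_and] at hv ⊢
      exact ⟨hv.2, hmono _ _ hv.1.1⟩
    · intro τ hτ u hu v hv hJ
      simp only [Finset.mem_filter, Finset.mem_univ, true_and] at hu ⊢
      exact ⟨hv, hstep i τ u v hτ hJ (hu.2.imp_right fun h => ⟨h, hv⟩) hu.1⟩
  have hfwd' : ∀ i < w, G ^ (i + 1) <
      ((block n lo s).filter fun v : Fin n => (T (i + 1)).stage v ≠ 0).card := by
    intro i
    induction i with
    | zero =>
      intro hi
      refine hfwd 0 hi ?_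
      rw [pow_zero, Nat.one_le_iff_ne_zero, Finset.card_ne_zero]
      exact ⟨⟨0, by omega⟩, by simp [hT, grow, root]⟩
    | succ i ih =>
      intro hi
      refine hfwd (i + 1) hi ((ih (by omega)).le.trans (Finset.card_le_card fun v hv => ?_))
      simp only [Finset.mem_filter, Finset.mem_univ, true_and] at hv ⊢
      exact ⟨hv.2, Or.inl hv.1⟩
  -- growth backwards from `x`
  have hbwd : ∀ i < w + w, ∀ j < w, ∀ S : Finset (Fin n), (∀ v ∈ S, (T (i + 1)).stage v = 0) →
      G ^ j ≤ S.card → G ^ (j + 1) <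
      ((block n lo s).filter fun v : Fin n => (T i).stage v = 0).card := by
    intro i hi j hj S hS hcard
    refine (hexp i hi).lt_card hG hGn hj hcard ?_ ?_
    · intro v hv
      rw [Finset.mem_inter] at hv
      rw [Finset.mem_filter]
      refine ⟨hv.2, ?_⟩
      by_contra h
      exact hmono _ _ h (hS v hv.1)
    · intro τ hτ u hu v hv hJ
      rw [Finset.mem_filter]
      refine ⟨hv, ?_⟩
      by_contra h
      exact hstep i τ v u hτ hJ.symm (Or.inl hv) h (hS u hu)
  have hbwd' : ∀ j < w, G ^ (j + 1) <
      ((block n lo s).filter fun v : Fin n => (T (w + w - (j + 1))).stage v = 0).card := by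
    intro j
    induction j with
    | zero =>
      intro hj
      refine hbwd (w + w - 1) (by omega) 0 hj {x} ?_ (by simp)
      intro v hv
      rw [Finset.mem_singleton] at hv
      rw [hv, Nat.sub_add_cancel (by omega)]
      exact hx
    | succ j ih =>
      intro hj
      refine hbwd (w + w - (j + 1 + 1)) (by omega) (j + 1) hj
        ((block n lo s).filter fun v : Fin n => (T (w + w - (j + 1))).stage v = 0) ?_
        (ih (by omega)).le
      intro v hv
      rw [show w + w - (j + 1 + 1) + 1 = w + w - (j + 1) by omega]
      exact (Finset.mem_filter.1 hv).2
  have h1 := hfwd' (w - 1) (by omega)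
  have h2 := hbwd' (w - 1) (by omega)
  rw [Nat.sub_add_cancel hw] at h1 h2
  rw [show w + w - w = w by omega] at h2
  have h3 := Finset.card_filter_add_card_filter_not (s := block n lo s)
    (fun v : Fin n => (T w).stage v = 0)
  rw [card_block hlos] at h3
  simp only [ne_eq] at h1
  omega

end Expansion

/-! ### Random queries expand -/

section RandomQueries

variable {n : ℕ}

/-- The pairs between `S` and the part of the block outside `T`. -/
def crossing (lo s : ℕ) (S T : Finset (Fin n)) : Finset (Pair n) :=
  Finset.univ.filter fun p => ∃ u ∈ S, ∃ v ∈ block n lo s \ T, Joins p u v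

theorem le_card_crossing {lo s : ℕ} (hlos : lo + s ≤ n) {S T : Finset (Fin n)}
    (hST : S ∩ block n lo s ⊆ T) : S.card * (s - T.card) ≤ (crossing lo s S T).card := by
  calc S.card * (s - T.card) ≤ S.card * (block n lo s \ T).card := by
        refine Nat.mul_le_mul_left _ ?_
        have := Finset.le_card_sdiff T (block n lo s)
        rwa [card_block hlos] at this
    _ = (S ×ˢ (block n lo s \ T)).card := (Finset.card_product _ _).symm
    _ ≤ (crossing lo s S T).card := by
        refine Finset.card_le_card_of_surjOn (fun p => if p.1.1 ∈ S ∧ p.1.2 ∈ block n lo s \ T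
          then p.1 else (p.1.2, p.1.1)) ?_
        rintro ⟨u, v⟩ h
        simp only [Finset.coe_product, Set.mem_prod, Finset.mem_coe] at h
        obtain ⟨hu, hv⟩ := h
        have hv' := Finset.mem_sdiff.1 hv
        have hvS : v ∉ S := fun h => hv'.2 (hST (Finset.mem_inter.2 ⟨h, hv'.1⟩))
        rcases lt_trichotomy u v with h | h | h
        · refine ⟨⟨(u, v), h⟩, ?_, ?_⟩
          · simp only [crossing, Finset.coe_filter, Finset.mem_univ, true_and, Set.mem_ofPred_eq]
            exact ⟨u, hu, v, hv, Or.inl rfl⟩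
          · exact if_pos ⟨hu, hv⟩
        · exact absurd (h ▸ hu) hvS
        · refine ⟨⟨(v, u), h⟩, ?_, ?_⟩
          · simp only [crossing, Finset.coe_filter, Finset.mem_univ, true_and, Set.mem_ofPred_eq]
            exact ⟨u, hu, v, hv, Or.inr rfl⟩
          · exact if_neg fun h => hvS h.1

theorem card_pair_le (n : ℕ) : Fintype.card (Pair n) ≤ n ^ 2 := by
  calc Fintype.card (Pair n) ≤ Fintype.card (Fin n × Fin n) := Fintype.card_subtype_le _
    _ = n ^ 2 := by simp [sq]

/-- The law of `m` independent uniform pairs. -/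
noncomputable abbrev queryLaw (n m : ℕ) : Measure (Fin m → Pair n) :=
  Measure.pi fun _ : Fin m => ProbabilityTheory.uniformOn (Set.univ : Set (Pair n))

variable [Nonempty (Pair n)]

instance : IsProbabilityMeasure (ProbabilityTheory.uniformOn (Set.univ : Set (Pair n))) :=
  ProbabilityTheory.isProbabilityMeasure_uniformOn Set.finite_univ Set.univ_nonempty

theorem uniformOn_compl_le (J : Finset (Pair n)) :
    (ProbabilityTheory.uniformOn (Set.univ : Set (Pair n))).real (J : Set (Pair n))ᶜ ≤
      Real.exp (-(J.card / (n : ℝ) ^ 2)) := by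
  have hpos : 0 < Fintype.card (Pair n) := Fintype.card_pos
  have hJ : (ProbabilityTheory.uniformOn (Set.univ : Set (Pair n))).real (J : Set (Pair n)) =
      J.card / Fintype.card (Pair n) := by
    rw [measureReal_def, ProbabilityTheory.uniformOn_univ]
    simp [Measure.count_apply_finset]
  rw [probReal_compl_eq_one_sub (Finset.measurableSet J), hJ]
  have h1 : (J.card : ℝ) / (n : ℝ) ^ 2 ≤ J.card / Fintype.card (Pair n) := by
    refine div_le_div_of_nonneg_left (by positivity) (by exact_mod_cast hpos) ?_
    exact_mod_cast card_pair_le n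
  have h2 := Real.add_one_le_exp (-((J.card : ℝ) / (n : ℝ) ^ 2))
  linarith

/-- The probability that `Q` given queries all miss a set of pairs. -/
theorem queryLaw_avoid_le {m : ℕ} (J : Finset (Pair n)) (I : Finset (Fin m)) :
    (queryLaw n m).real {e | ∀ i ∈ I, e i ∉ J} ≤
      Real.exp (-(I.card * (J.card / (n : ℝ) ^ 2))) := by
  classical
  have : {e : Fin m → Pair n | ∀ i ∈ I, e i ∉ J} =
      Set.univ.pi fun i => if i ∈ I then (J : Set (Pair n))ᶜ else Set.univ := by
    ext e
    simp only [Set.mem_ofPred_eq, Set.mem_univ_pi]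
    refine forall_congr' fun i => ?_
    split_ifs with h <;> simp [h]
  rw [this, measureReal_def, Measure.pi_pi, ENNReal.toReal_prod]
  have h2 : ∀ i, (ProbabilityTheory.uniformOn (Set.univ : Set (Pair n))
      (if i ∈ I then (J : Set (Pair n))ᶜ else Set.univ)).toReal =
      if i ∈ I then
        (ProbabilityTheory.uniformOn (Set.univ : Set (Pair n))).real (J : Set (Pair n))ᶜ
      else 1 := by
    intro i
    split_ifs <;> simp [measureReal_def]
  simp only [h2]
  rw [Finset.prod_ite_mem, Finset.univ_inter, Finset.prod_const, ← mul_neg, Real.exp_nat_mul]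
  exact pow_le_pow_left₀ measureReal_nonneg (uniformOn_compl_le J) _

/-- The sequence of queries, continued arbitrarily. -/
noncomputable def extend {m : ℕ} (e : Fin m → Pair n) (j : ℕ) : Pair n :=
  if h : j < m then e ⟨j, h⟩ else Classical.arbitrary _

/-- The union bound for one round: there are at most `n ^ (2 G ^ (j + 1)) ≤ exp (26 G ^ (j + 2))` pairs
of sets `S`, `T`, and the queries between `S` and the block outside `T` are all missing with
probability at most `exp (- G ^ (j + 3))`. -/
theorem queryLaw_not_expanding_le {m b Q lo s G w : ℕ} (hb : b + Q ≤ m) (hlos : lo + s ≤ n)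
    (hs : s = 2 * G ^ w) (hG : 0 < G) (hn : n ≤ G ^ (w + 12)) (hQ : Q = n * G ^ 15)
    (hlog : Real.log n ≤ 13 * G) (hG54 : 54 ≤ G) :
    (queryLaw n m).real {e | ¬ Expanding n lo s G w Q fun τ => extend e (b + τ)} ≤
      w * Real.exp (-(G : ℝ) ^ 2) := by
  classical
  let I : Finset (Fin m) := Finset.univ.filter fun i => b ≤ (i : ℕ) ∧ (i : ℕ) < b + Q
  have hI : I.card = Q := by
    have : I.map Fin.valEmbedding = Finset.Ico b (b + Q) := by
      ext v
      simp only [I, Finset.mem_map, Finset.mem_filter, Finset.mem_univ, true_and,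
        Fin.valEmbedding_apply, Finset.mem_Ico]
      constructor
      · rintro ⟨u, hu, rfl⟩; exact hu
      · intro hv; exact ⟨⟨v, by omega⟩, hv, rfl⟩
    rw [← Finset.card_map, this, Nat.card_Ico]
    omega
  let F : ℕ → Finset (Finset (Fin n) × Finset (Fin n)) := fun j =>
    (Finset.powersetCard (G ^ j) Finset.univ ×ˢ Finset.powersetCard (G ^ (j + 1)) Finset.univ).filter
      fun x => x.1 ∩ block n lo s ⊆ x.2
  have hsub : {e : Fin m → Pair n | ¬ Expanding n lo s G w Q fun τ => extend e (b + τ)} ⊆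
      ⋃ j ∈ Finset.range w, ⋃ x ∈ F j, {e | ∀ i ∈ I, e i ∉ crossing lo s x.1 x.2} := by
    intro e he
    simp only [Set.mem_ofPred_eq, Expanding, not_forall] at he
    obtain ⟨j, hj, S, T, hS, hT, hST, hno⟩ := he
    simp only [Set.mem_iUnion, Finset.mem_range]
    refine ⟨j, hj, (S, T), ?_, ?_⟩
    · simp [F, hS, hT, hST]
    · intro i hi hmem
      simp only [I, Finset.mem_filter, Finset.mem_univ, true_and] at hi
      simp only [crossing, Finset.mem_filter, Finset.mem_univ, true_and] at hmem
      refine hno ⟨i - b, by omega, ?_⟩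
      have : extend e (b + (i - b)) = e i := by
        simp [extend, Nat.add_sub_cancel' hi.1]
      rw [this]
      exact hmem
  have hn0 : 0 < n := by
    have := card_pair_le n
    have h2 : 0 < Fintype.card (Pair n) := Fintype.card_pos
    by_contra h
    have : n = 0 := by omega
    subst this
    simp at *
  have hterm : ∀ j ∈ Finset.range w, (queryLaw n m).real
      (⋃ x ∈ F j, {e | ∀ i ∈ I, e i ∉ crossing lo s x.1 x.2}) ≤ Real.exp (-(G : ℝ) ^ 2) := by
    intro j hj
    rw [Finset.mem_range] at hj
    have hGR : (1 : ℝ) ≤ G := by exact_mod_cast hG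
    have hone : ∀ x ∈ F j, (queryLaw n m).real {e | ∀ i ∈ I, e i ∉ crossing lo s x.1 x.2} ≤
        Real.exp (-((G : ℝ) ^ j * G ^ 3)) := by
      rintro ⟨S, T⟩ hx
      simp only [F, Finset.mem_filter, Finset.mem_product, Finset.mem_powersetCard_univ] at hx
      obtain ⟨⟨hS, hT⟩, hST⟩ := hx
      refine (queryLaw_avoid_le _ _).trans (Real.exp_le_exp.2 (neg_le_neg ?_))
      have h1 := le_card_crossing hlos hST
      have h2 : G ^ w ≤ s - T.card := by
        have := Nat.pow_le_pow_right hG (show j + 1 ≤ w by omega)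
        omega
      have h3 : G ^ j * G ^ w ≤ (crossing lo s S T).card := by
        refine le_trans ?_ h1
        rw [hS]; exact Nat.mul_le_mul_left _ h2
      have h3' : (G : ℝ) ^ j * (G : ℝ) ^ w ≤ (crossing lo s S T).card := by exact_mod_cast h3
      have hn' : (n : ℝ) ≤ (G : ℝ) ^ (w + 12) := by exact_mod_cast hn
      have hn0' : (0 : ℝ) < n := by exact_mod_cast hn0
      rw [hI, hQ]
      push_cast
      have h4 : (n : ℝ) * G ^ 15 * ((crossing lo s S T).card / (n : ℝ) ^ 2) =
          G ^ 15 * (crossing lo s S T).card / n := by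
        field_simp
      rw [h4, le_div_iff₀ hn0']
      calc (G : ℝ) ^ j * G ^ 3 * n ≤ (G : ℝ) ^ j * G ^ 3 * (G : ℝ) ^ (w + 12) := by gcongr
        _ = G ^ 15 * ((G : ℝ) ^ j * (G : ℝ) ^ w) := by ring
        _ ≤ _ := by gcongr
    have hcard : ((F j).card : ℝ) ≤ Real.exp (26 * (G : ℝ) ^ j * G ^ 2) := by
      have h1 : (F j).card ≤ n ^ (G ^ j) * n ^ (G ^ (j + 1)) := by
        refine (Finset.card_filter_le _ _).trans ?_
        rw [Finset.card_product, Finset.card_powersetCard, Finset.card_powersetCard,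
          Finset.card_univ, Fintype.card_fin]
        exact Nat.mul_le_mul (Nat.choose_le_pow _ _) (Nat.choose_le_pow _ _)
      have h2 : (n : ℝ) ≤ Real.exp (13 * G) := by
        rw [← Real.exp_log (show (0 : ℝ) < n by exact_mod_cast hn0)]
        exact Real.exp_le_exp.2 hlog
      calc ((F j).card : ℝ) ≤ (n : ℝ) ^ (G ^ j) * (n : ℝ) ^ (G ^ (j + 1)) := by exact_mod_cast h1
        _ = (n : ℝ) ^ (G ^ j + G ^ (j + 1)) := (pow_add _ _ _).symm
        _ ≤ Real.exp (13 * G) ^ (G ^ j + G ^ (j + 1)) := by gcongr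
        _ = Real.exp ((G ^ j + G ^ (j + 1)) * (13 * G)) := by
            rw [← Real.exp_nat_mul]; push_cast; rfl
        _ ≤ Real.exp (26 * (G : ℝ) ^ j * G ^ 2) := by
            refine Real.exp_le_exp.2 ?_
            have h3 : (G : ℝ) ^ j ≤ (G : ℝ) ^ (j + 1) := pow_le_pow_right₀ hGR (by omega)
            calc ((G : ℝ) ^ j + (G : ℝ) ^ (j + 1)) * (13 * G)
                ≤ ((G : ℝ) ^ (j + 1) + (G : ℝ) ^ (j + 1)) * (13 * G) := by gcongr
              _ = _ := by ring
    calc (queryLaw n m).real (⋃ x ∈ F j, {e | ∀ i ∈ I, e i ∉ crossing lo s x.1 x.2})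
        ≤ ∑ x ∈ F j, (queryLaw n m).real {e | ∀ i ∈ I, e i ∉ crossing lo s x.1 x.2} :=
          measureReal_biUnion_finset_le _ _
      _ ≤ ∑ _x ∈ F j, Real.exp (-((G : ℝ) ^ j * G ^ 3)) := Finset.sum_le_sum hone
      _ = (F j).card * Real.exp (-((G : ℝ) ^ j * G ^ 3)) := by simp
      _ ≤ Real.exp (26 * (G : ℝ) ^ j * G ^ 2) * Real.exp (-((G : ℝ) ^ j * G ^ 3)) := by gcongr
      _ = Real.exp (-((G : ℝ) ^ j * G ^ 2 * (G - 26))) := by rw [← Real.exp_add]; ring_nf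
      _ ≤ Real.exp (-(G : ℝ) ^ 2) := by
          refine Real.exp_le_exp.2 (neg_le_neg ?_)
          have h1 : (1 : ℝ) ≤ (G : ℝ) ^ j := one_le_pow₀ hGR
          have h2 : (54 : ℝ) ≤ G := by exact_mod_cast hG54
          have h3 : (1 : ℝ) ≤ G - 26 := by linarith
          calc (G : ℝ) ^ 2 = 1 * (G : ℝ) ^ 2 * 1 := by ring
            _ ≤ _ := by gcongr
  calc (queryLaw n m).real {e | ¬ Expanding n lo s G w Q fun τ => extend e (b + τ)}
      ≤ (queryLaw n m).real (⋃ j ∈ Finset.range w,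
          ⋃ x ∈ F j, {e | ∀ i ∈ I, e i ∉ crossing lo s x.1 x.2}) :=
        measureReal_mono hsub (measure_ne_top _ _)
    _ ≤ ∑ j ∈ Finset.range w, (queryLaw n m).real
          (⋃ x ∈ F j, {e | ∀ i ∈ I, e i ∉ crossing lo s x.1 x.2}) :=
        measureReal_biUnion_finset_le _ _
    _ ≤ ∑ _j ∈ Finset.range w, Real.exp (-(G : ℝ) ^ 2) := Finset.sum_le_sum hterm
    _ = w * Real.exp (-(G : ℝ) ^ 2) := by simp

end RandomQueries

/-! ### The error along a path -/

section Smoothing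

variable {k : ℕ}

/-- The translation of functions by `a`. -/
def translate (a : ZMod k) : Module.End ℝ (ZMod k → ℝ) where
  toFun f c := f (c + a)
  map_add' _ _ := rfl
  map_smul' _ _ := rfl

theorem translate_apply (a : ZMod k) (f : ZMod k → ℝ) (c : ZMod k) :
    translate a f c = f (c + a) := rfl

theorem translate_mul (a b : ZMod k) : translate a * translate b = translate (a + b) := by
  ext f c
  simp [translate_apply, Module.End.mul_apply, add_assoc]

theorem commute_translate (a b : ZMod k) : Commute (translate a) (translate b) := by
  rw [Commute, SemiconjBy, translate_mul, translate_mul, add_comm]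

/-- The average of a function and its translate. -/
noncomputable def halfStep (a : ZMod k) : Module.End ℝ (ZMod k → ℝ) :=
  (1 / 2 : ℝ) • (1 + translate a)

theorem commute_translate_halfStep (a b : ZMod k) : Commute (translate a) (halfStep b) :=
  ((Commute.one_right _).add_right (commute_translate a b)).smul_right _

theorem commute_halfStep (a b : ZMod k) : Commute (halfStep a) (halfStep b) :=
  ((Commute.one_left _).add_left (commute_translate_halfStep a b)).smul_left _

/-- The transition operator of the lazy random walk. -/
noncomputable def lazyStep (k : ℕ) : Module.End ℝ (ZMod k → ℝ) := halfStep 1 * halfStep (-1)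

/-- The expectation operator of one error. -/
noncomputable def errorStep (k : ℕ) (q : ℝ) : Module.End ℝ (ZMod k → ℝ) :=
  (1 - 2 * q) • 1 + (2 * q) • lazyStep k

theorem errorStep_apply (q : ℝ) (f : ZMod k → ℝ) (c : ZMod k) :
    errorStep k q f c = (1 - q) * f c + q / 2 * f (c + 1) + q / 2 * f (c - 1) := by
  simp only [errorStep, lazyStep, halfStep, LinearMap.add_apply, LinearMap.smul_apply,
    Module.End.one_apply, Module.End.mul_apply, Pi.add_apply, Pi.smul_apply, smul_eq_mul,
    translate_apply, map_smul, map_add]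
  rw [add_neg_cancel_right, ← sub_eq_add_neg]
  ring

variable [NeZero k]

theorem sum_halfStep_mul (a : ZMod k) (f h : ZMod k → ℝ) :
    ∑ c, halfStep a f c * h c = ∑ c, f c * halfStep (-a) h c := by
  have h1 : ∑ c, f (c + a) * h c = ∑ c, f c * h (c + -a) := by
    refine Fintype.sum_equiv (Equiv.addRight a) _ _ fun c => ?_
    simp
  simp only [halfStep, LinearMap.smul_apply, LinearMap.add_apply, Module.End.one_apply,
    Pi.smul_apply, Pi.add_apply, smul_eq_mul, translate_apply, mul_add, add_mul, mul_assoc,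
    mul_left_comm (f _) (1 / 2 : ℝ), Finset.sum_add_distrib, ← Finset.mul_sum, h1]

theorem sum_halfStep_pow_mul (a : ZMod k) (i : ℕ) (f h : ZMod k → ℝ) :
    ∑ c, (halfStep a ^ i) f c * h c = ∑ c, f c * (halfStep (-a) ^ i) h c := by
  induction i generalizing f h with
  | zero => simp
  | succ i ih =>
    rw [pow_succ, Module.End.mul_apply, ih, sum_halfStep_mul, pow_succ', Module.End.mul_apply]

/-- The lazy random walk is the composition of a walk and its reverse, so it is most likely to be
found where it started, by the inequality of Cauchy and Schwarz. -/
theorem lazyStep_pow_nonneg (d : ZMod k) (i : ℕ) :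
    0 ≤ (lazyStep k ^ i) (Pi.single 0 1 - Pi.single d 1) 0 := by
  have h1 : ∀ f : ZMod k → ℝ, (lazyStep k ^ i) f 0 =
      ∑ c, (halfStep (-1) ^ i) (Pi.single 0 1) c * (halfStep (-1) ^ i) f c := by
    intro f
    rw [lazyStep, (commute_halfStep _ _).mul_pow, Module.End.mul_apply, sum_halfStep_pow_mul]
    simp [Pi.single_apply]
  set u : ZMod k → ℝ := (halfStep (-1) ^ i) (Pi.single 0 1) with hu
  have h2 : (halfStep (-1) ^ i) (Pi.single d 1) = translate (-d) u := by
    have h3 : (Pi.single d 1 : ZMod k → ℝ) = translate (-d) (Pi.single 0 1) := by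
      ext c
      simp [translate_apply, Pi.single_apply, ← sub_eq_add_neg, sub_eq_zero]
    rw [h3, hu, ← Module.End.mul_apply, ← Module.End.mul_apply,
      ((commute_translate_halfStep (-d) (-1)).pow_right i).eq]
  have h4 : ∑ c, u (c + -d) ^ 2 = ∑ c, u c ^ 2 :=
    Fintype.sum_equiv (Equiv.addRight (-d)) _ _ fun c => by simp
  rw [map_sub, Pi.sub_apply, h1, h1, h2, ← hu]
  simp only [translate_apply]
  have h5 : ∑ c, u c * u (c + -d) ≤ ∑ c, (u c ^ 2 + u (c + -d) ^ 2) / 2 :=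
    Finset.sum_le_sum fun c _ => by nlinarith [sq_nonneg (u c - u (c + -d))]
  rw [← Finset.sum_div, Finset.sum_add_distrib, h4] at h5
  have h6 : ∑ c, u c * u c = ∑ c, u c ^ 2 := Finset.sum_congr rfl fun c _ => (sq _).symm
  linarith

omit [NeZero k] in
/-- Expanding the power of `errorStep`, all terms are nonnegative, and the first one is the left-hand
side. -/
theorem le_errorStep_pow {q : ℝ} (hq0 : 0 ≤ q) (hq : q ≤ 1 / 2) (l : ℕ) (f : ZMod k → ℝ)
    (hf : ∀ i, 0 ≤ (lazyStep k ^ i) f 0) : (1 - 2 * q) ^ l * f 0 ≤ (errorStep k q ^ l) f 0 := by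
  induction l generalizing f with
  | zero => simp
  | succ l ih =>
    have h1 : ∀ i, (lazyStep k ^ i) (errorStep k q f) 0 =
        (1 - 2 * q) * (lazyStep k ^ i) f 0 + 2 * q * (lazyStep k ^ (i + 1)) f 0 := by
      intro i
      simp [errorStep, pow_succ, Module.End.mul_apply]
    have h2 := ih (errorStep k q f) fun i => by
      rw [h1]
      have h3 := mul_nonneg (sub_nonneg.2 (by linarith : 2 * q ≤ 1)) (hf i)
      have h4 := mul_nonneg (by linarith : 0 ≤ 2 * q) (hf (i + 1))
      linarith
    have h5 : (1 - 2 * q) * f 0 ≤ errorStep k q f 0 := by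
      have h6 := h1 0
      have h7 := mul_nonneg (by linarith : 0 ≤ 2 * q) (hf 1)
      simp only [pow_zero, Module.End.one_apply, zero_add] at h6
      rw [h6]
      linarith
    have h8 := mul_le_mul_of_nonneg_left h5 (pow_nonneg (sub_nonneg.2 (by linarith : 2 * q ≤ 1)) l)
    calc (1 - 2 * q) ^ (l + 1) * f 0 = (1 - 2 * q) ^ l * ((1 - 2 * q) * f 0) := by ring
      _ ≤ _ := h8
      _ ≤ _ := h2
      _ = _ := by rw [pow_succ (errorStep k q), Module.End.mul_apply]

end Smoothing

section ErrorLaw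

variable {k : ℕ} {q : ℝ}

theorem isProbabilityMeasure_errorLaw (hq0 : 0 ≤ q) (hq : q ≤ 1) :
    IsProbabilityMeasure (errorLaw k q) := by
  constructor
  simp only [errorLaw, Measure.add_apply, Measure.smul_apply, measure_univ, smul_eq_mul, mul_one]
  rw [← ENNReal.ofReal_add (by linarith) (by linarith), ← ENNReal.ofReal_add (by linarith)
    (by linarith)]
  simp

theorem integral_errorLaw (hq0 : 0 ≤ q) (hq : q ≤ 1) (f : ZMod k → ℝ) (z : ZMod k) {σ : ℤ}
    (hσ : σ = 1 ∨ σ = -1) : ∫ x, f (z + σ • x) ∂errorLaw k q = errorStep k q f z := by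
  have hi : ∀ (c : ℝ) (a : ZMod k) (h : ZMod k → ℝ),
      Integrable h (ENNReal.ofReal c • Measure.dirac a) := fun c a h =>
    (integrable_dirac (by simp)).smul_measure ENNReal.ofReal_ne_top
  rw [errorLaw, integral_add_measure (hi _ _ _) ((hi _ _ _).add_measure (hi _ _ _)),
    integral_add_measure (hi _ _ _) (hi _ _ _)]
  simp only [integral_smul_measure, integral_dirac]
  rw [ENNReal.toReal_ofReal (by linarith), ENNReal.toReal_ofReal (by linarith), errorStep_apply]
  rcases hσ with rfl | rfl <;> simp <;> ring_nf

variable [NeZero k]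

/-- The joint law of the errors. -/
noncomputable abbrev errorsLaw (k n : ℕ) (q : ℝ) : Measure (Pair n → ZMod k) :=
  Measure.pi fun _ : Pair n => errorLaw k q

variable {n : ℕ}

/-- The expectation of a function of the sum of the errors along a path. -/
theorem integral_sum_errors (hq0 : 0 ≤ q) (hq : q ≤ 1) (c : Pair n → ℤ) (F : Finset (Pair n))
    (hc : ∀ p ∈ F, c p = 1 ∨ c p = -1) (f : ZMod k → ℝ) (z : ZMod k) :
    ∫ err, f (z + ∑ p ∈ F, c p • err p) ∂errorsLaw k n q = (errorStep k q ^ F.card) f z := by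
  classical
  have := isProbabilityMeasure_errorLaw (k := k) hq0 hq
  have hind : ProbabilityTheory.iIndepFun (fun p (err : Pair n → ZMod k) => c p • err p)
      (errorsLaw k n q) := ProbabilityTheory.iIndepFun_pi (X := fun p (x : ZMod k) => c p • x)
    fun p => (measurable_of_finite _).aemeasurable
  induction F using Finset.induction_on generalizing z with
  | empty => simp
  | insert p F hp ih =>
    have h1 := hind.indepFun_finsetSum_of_notMem (fun p => measurable_of_finite _) hp
    have hX : AEMeasurable (∑ j ∈ F, fun err : Pair n → ZMod k => c j • err j)
      (errorsLaw k n q) := (measurable_of_finite _).aemeasurable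
    have hY : AEMeasurable (fun err : Pair n → ZMod k => c p • err p)
      (errorsLaw k n q) := (measurable_of_finite _).aemeasurable
    rw [ProbabilityTheory.indepFun_iff_map_prod_eq_prod_map_map hX hY] at h1
    have h2 : ∫ err, f (z + ∑ p ∈ insert p F, c p • err p) ∂errorsLaw k n q =
        ∫ x : ZMod k × ZMod k, f (z + x.2 + x.1) ∂(errorsLaw k n q).map
          (fun err => ((∑ j ∈ F, fun err : Pair n → ZMod k => c j • err j) err, c p • err p)) := by
      rw [integral_map (measurable_of_finite _).aemeasurable
        (measurable_of_finite _).aestronglyMeasurable]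
      simp only [Finset.sum_insert hp, Finset.sum_apply, add_assoc]
    have := Measure.isProbabilityMeasure_map hX
    have := Measure.isProbabilityMeasure_map hY
    rw [h2, h1, integral_prod_symm _ Integrable.of_finite,
      integral_map hY (measurable_of_finite _).aestronglyMeasurable]
    have h3 : ∀ err : Pair n → ZMod k, ∫ x : ZMod k, f (z + c p • err p + x) ∂(errorsLaw k n q).map
        (∑ j ∈ F, fun err : Pair n → ZMod k => c j • err j) =
        (errorStep k q ^ F.card) f (z + c p • err p) := by
      intro err
      rw [← ih (fun p hp => hc p (Finset.mem_insert_of_mem hp)),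
        integral_map hX (measurable_of_finite _).aestronglyMeasurable]
      simp only [Finset.sum_apply]
    simp only [h3]
    rw [Finset.card_insert_of_notMem hp, pow_succ', Module.End.mul_apply,
      ← integral_errorLaw hq0 hq _ z (hc p (Finset.mem_insert_self _ _))]
    have h4 := (measurePreserving_eval (fun _ : Pair n => errorLaw k q) p)
    rw [← h4.map_eq, integral_map (measurable_of_finite _).aemeasurable
      (measurable_of_finite _).aestronglyMeasurable]

/-- The errors along paths with different pairs are independent. -/
theorem iIndepFun_evalPairs (hq0 : 0 ≤ q) (hq : q ≤ 1) {ι : Type*} (c : ι → Pair n → ℤ)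
    (hc : ∀ i j, i ≠ j → ∀ p, c i p ≠ 0 → c j p = 0) :
    ProbabilityTheory.iIndepFun (fun i (err : Pair n → ZMod k) => evalPairs err (c i))
      (errorsLaw k n q) := by
  classical
  have := isProbabilityMeasure_errorLaw (k := k) hq0 hq
  have hind : ProbabilityTheory.iIndepFun (fun p (err : Pair n → ZMod k) => err p)
      (errorsLaw k n q) := ProbabilityTheory.iIndepFun_pi (X := fun p (x : ZMod k) => x)
    fun p => (measurable_of_finite _).aemeasurable
  let U : ι → Finset (Pair n) := fun i => Finset.univ.filter fun p => c i p ≠ 0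
  have hU : ∀ i (err : Pair n → ZMod k), evalPairs err (c i) = ∑ p ∈ U i, c i p • err p := by
    intro i err
    simp only [evalPairs, AddMonoidHom.coe_mk, ZeroHom.coe_mk]
    symm
    refine Finset.sum_subset (Finset.subset_univ _) fun p _ hp => ?_
    have : c i p = 0 := by simpa [U] using hp
    simp [this]
  rw [ProbabilityTheory.iIndepFun_iff_measure_inter_preimage_eq_mul]
  intro S sets _
  induction S using Finset.induction_on with
  | empty => simp
  | insert i S hi ih =>
    have hdisj : Disjoint (U i) (S.biUnion U) := by
      rw [Finset.disjoint_left]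
      intro p hp hp'
      obtain ⟨j, hj, hpj⟩ := Finset.mem_biUnion.1 hp'
      have hij : i ≠ j := fun h => hi (h ▸ hj)
      simp only [U, Finset.mem_filter, Finset.mem_univ, true_and] at hp hpj
      exact hpj (hc i j hij p hp)
    have h1 := hind.indepFun_finset (U i) (S.biUnion U) hdisj fun p => measurable_pi_apply p
    have h2 := h1.measure_inter_preimage_eq_mul
      {y : U i → ZMod k | ∑ p : U i, c i p • y p ∈ sets i}
      {y : ↥(S.biUnion U) → ZMod k | ∀ j, ∀ hj : j ∈ S,
        ∑ p : U j, c j p • y ⟨p, Finset.mem_biUnion.2 ⟨j, hj, p.2⟩⟩ ∈ sets j}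
      (MeasurableSet.of_discrete) (MeasurableSet.of_discrete)
    have h3 : (fun err (p : U i) => err p : (Pair n → ZMod k) → U i → ZMod k) ⁻¹'
        {y : U i → ZMod k | ∑ p : U i, c i p • y p ∈ sets i} =
        (fun err : Pair n → ZMod k => evalPairs err (c i)) ⁻¹' sets i := by
      ext err
      simp only [Set.mem_preimage, Set.mem_ofPred_eq, hU]
      rw [Finset.sum_coe_sort (U i) fun p => c i p • err p]
    have h4 : (fun err (p : ↥(S.biUnion U)) => err p :
          (Pair n → ZMod k) → ↥(S.biUnion U) → ZMod k) ⁻¹'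
        {y : ↥(S.biUnion U) → ZMod k | ∀ j, ∀ hj : j ∈ S,
          ∑ p : U j, c j p • y ⟨p, Finset.mem_biUnion.2 ⟨j, hj, p.2⟩⟩ ∈ sets j} =
        ⋂ j ∈ S, (fun err : Pair n → ZMod k => evalPairs err (c j)) ⁻¹' sets j := by
      ext err
      simp only [Set.mem_preimage, Set.mem_ofPred_eq, hU, Set.mem_iInter]
      refine forall₂_congr fun j hj => ?_
      rw [Finset.sum_coe_sort (U j) fun p => c j p • err p]
    rw [h3, h4] at h2
    rw [Finset.set_biInter_insert, Finset.prod_insert hi, h2,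
      ih fun _ _ => MeasurableSet.of_discrete]

/-- Hoeffding's bound for the vote of `R` independent paths with at most `l` pairs each: the correct
value, with error `0`, gets more votes than the value with error `d`. -/
theorem errorsLaw_vote_le (hq0 : 0 ≤ q) (hq : q ≤ 1 / 2) {R l : ℕ} (c : Fin R → Pair n → ℤ)
    (hc : ∀ i p, c i p ≠ 0 → c i p = 1 ∨ c i p = -1)
    (hdisj : ∀ i j, i ≠ j → ∀ p, c i p ≠ 0 → c j p = 0)
    (hl : ∀ i, (Finset.univ.filter fun p => c i p ≠ 0).card ≤ l) {d : ZMod k} (hd : d ≠ 0) :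
    (errorsLaw k n q).real {err | (Finset.univ.filter fun i => evalPairs err (c i) = 0).card ≤
        (Finset.univ.filter fun i => evalPairs err (c i) = d).card} ≤
      Real.exp (-(R * ((1 - 2 * q) ^ l) ^ 2 / 2)) := by
  classical
  have := isProbabilityMeasure_errorLaw (k := k) hq0 (hq.trans (by norm_num))
  set β : ℝ := (1 - 2 * q) ^ l
  have hβ : 0 ≤ β := pow_nonneg (by linarith) _
  let f : ZMod k → ℝ := Pi.single 0 1 - Pi.single d 1
  -- the vote for `d` minus the vote for `0`
  let X : Fin R → (Pair n → ZMod k) → ℝ := fun i err => -f (evalPairs err (c i))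
  have hmean : ∀ i, ∫ err, X i err ∂errorsLaw k n q ≤ -β := by
    intro i
    have h1 := integral_sum_errors (k := k) hq0 (hq.trans (by norm_num)) (c i)
      (Finset.univ.filter fun p => c i p ≠ 0) (fun p hp => hc i p (Finset.mem_filter.1 hp).2) f 0
    have h2 : ∀ err : Pair n → ZMod k, 0 + ∑ p with c i p ≠ 0, c i p • err p =
        evalPairs err (c i) := by
      intro err
      simp only [zero_add, evalPairs, AddMonoidHom.coe_mk, ZeroHom.coe_mk]
      refine Finset.sum_subset (Finset.subset_univ _) fun p _ hp => ?_
      have : c i p = 0 := by simpa using hp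
      simp [this]
    simp only [h2] at h1
    have h3 := le_errorStep_pow hq0 hq (Finset.univ.filter fun p => c i p ≠ 0).card f
      fun j => lazyStep_pow_nonneg d j
    have h4 : f 0 = 1 := by simp [f, hd.symm]
    have h5 : β ≤ (1 - 2 * q) ^ (Finset.univ.filter fun p => c i p ≠ 0).card :=
      pow_le_pow_of_le_one (by linarith) (by linarith) (hl i)
    simp only [X, integral_neg, h1]
    rw [h4, mul_one] at h3
    linarith
  have hindep : ProbabilityTheory.iIndepFun
      (fun i err => X i err - ∫ err, X i err ∂errorsLaw k n q) (errorsLaw k n q) :=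
    (iIndepFun_evalPairs (k := k) hq0 (hq.trans (by norm_num)) c hdisj).comp
      (fun i z => -f z - ∫ err, X i err ∂errorsLaw k n q) fun i => measurable_of_finite _
  have hsub : ∀ i, ProbabilityTheory.HasSubgaussianMGF
      (fun err => X i err - ∫ err, X i err ∂errorsLaw k n q) ((‖(1 : ℝ) - -1‖₊ / 2) ^ 2)
      (errorsLaw k n q) := by
    intro i
    refine ProbabilityTheory.hasSubgaussianMGF_of_mem_Icc (measurable_of_finite _).aemeasurable
      (Filter.Eventually.of_forall fun err => ?_)
    simp only [X, f, Pi.sub_apply, Pi.single_apply, Set.mem_Icc]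
    split_ifs <;> norm_num
  have hhoeff := ProbabilityTheory.HasSubgaussianMGF.measure_sum_ge_le_of_iIndepFun hindep
    (s := Finset.univ) (fun i _ => hsub i) (ε := R * β) (by positivity)
  refine (measureReal_mono ?_ (measure_ne_top _ _)).trans (hhoeff.trans (Real.exp_le_exp.2 ?_))
  · intro err herr
    simp only [Set.mem_ofPred_eq] at herr ⊢
    have h1 : ∑ i, X i err = ((Finset.univ.filter fun i => evalPairs err (c i) = d).card : ℝ) -
        (Finset.univ.filter fun i => evalPairs err (c i) = 0).card := by
      simp only [X, f, Pi.sub_apply, Pi.single_apply, neg_sub, Finset.sum_sub_distrib,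
        Finset.sum_boole]
    have h2 : ∑ i, ∫ err, X i err ∂errorsLaw k n q ≤ ∑ _i : Fin R, -β :=
      Finset.sum_le_sum fun i _ => hmean i
    have h3 : ((Finset.univ.filter fun i => evalPairs err (c i) = 0).card : ℝ) ≤
        (Finset.univ.filter fun i => evalPairs err (c i) = d).card := by exact_mod_cast herr
    rw [Finset.sum_sub_distrib, h1]
    simp only [Finset.sum_const, Finset.card_univ, Fintype.card_fin, nsmul_eq_mul] at h2
    linarith
  · have h1 : ((∑ _i : Fin R, (‖(1 : ℝ) - -1‖₊ / 2) ^ 2 : NNReal) : ℝ) = R := by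
      norm_num
    rw [h1]
    rcases Nat.eq_zero_or_pos R with h | h
    · simp [h]
    · have : (0 : ℝ) < R := by exact_mod_cast h
      refine le_of_eq ?_
      field_simp

end ErrorLaw

/-! ### The size of the parameters -/

section Parameters

variable {n : ℕ}

theorem lt_threshold (w : ℕ) : w < threshold w := by
  unfold threshold
  have h1 : w ≤ w * w * (w + 1) := by
    rcases Nat.eq_zero_or_pos w with h | h
    · simp [h]
    · have := Nat.mul_le_mul (Nat.mul_le_mul h h) (Nat.le_refl (w + 1))
      omega
  have h2 := Nat.lt_two_pow_self (n := w * w * (w + 1))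
  omega

theorem threshold_level_lt (h : level n ≠ 0) : threshold (level n) < n :=
  Nat.findGreatest_of_ne_zero (P := fun w => threshold w < n) rfl h

theorem le_threshold_level_succ (n : ℕ) : n ≤ threshold (level n + 1) := by
  by_contra! hlt
  have h1 := lt_threshold (level n + 1)
  exact Nat.findGreatest_is_greatest (P := fun w => threshold w < n) (n := n)
    (Nat.lt_succ_self (level n)) (by omega) hlt

theorem fan_pos (n : ℕ) : 0 < fan n := Nat.two_pow_pos _

theorem blockSize_eq (n : ℕ) : blockSize n = 2 * fan n ^ level n := by
  rw [blockSize, fan, ← pow_mul]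

theorem roundLength_eq (n : ℕ) : roundLength n = n * fan n ^ 15 := by
  rw [roundLength, fan, ← pow_mul]

theorem fan_mul_blockSize (n : ℕ) : fan n * blockSize n = threshold (level n) := by
  simp only [fan, blockSize, threshold]
  ring

theorem le_fan_pow (h : level n ≠ 0) : n ≤ fan n ^ (level n + 12) := by
  refine (le_threshold_level_succ n).trans ?_
  generalize hw : level n = w at *
  rw [threshold, fan, hw, ← pow_mul, ← pow_succ']
  refine Nat.pow_le_pow_right two_pos ?_
  have : 1 ≤ w := Nat.one_le_iff_ne_zero.2 h
  nlinarith [Nat.mul_le_mul this this]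

theorem cube_le_two_pow_sq (w : ℕ) : w ^ 3 ≤ 2 ^ (w * w) := by
  rcases Nat.lt_or_ge w 3 with h | h
  · interval_cases w <;> norm_num
  · calc w ^ 3 ≤ (2 ^ w) ^ 3 := Nat.pow_le_pow_left Nat.lt_two_pow_self.le 3
      _ = 2 ^ (w * 3) := by rw [← pow_mul]
      _ ≤ 2 ^ (w * w) := Nat.pow_le_pow_right two_pos (Nat.mul_le_mul_left _ h)

theorem log_le (h : level n ≠ 0) : Real.log n ≤ 13 * (level n : ℝ) ^ 3 := by
  have hn : 0 < n := (Nat.zero_le _).trans_lt (threshold_level_lt h)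
  have h1 : (n : ℝ) ≤ (2 : ℝ) ^ (level n * level n * (level n + 12)) := by
    have := le_fan_pow h
    rw [fan, ← pow_mul] at this
    exact_mod_cast this
  have h2 := Real.log_le_log (by exact_mod_cast hn) h1
  rw [Real.log_pow] at h2
  have hw : (1 : ℝ) ≤ level n := by exact_mod_cast Nat.one_le_iff_ne_zero.2 h
  have h3 : Real.log 2 ≤ 1 := by linarith [Real.log_two_lt_d9]
  push_cast at h2
  have hww : 0 ≤ (level n : ℝ) * level n := mul_self_nonneg _
  calc Real.log n ≤ (level n : ℝ) * level n * (level n + 12) * Real.log 2 := h2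
    _ ≤ (level n : ℝ) * level n * (level n + 12) * 1 := by gcongr
    _ ≤ (level n : ℝ) * level n * (level n + 12 * level n) * 1 := by gcongr; linarith
    _ = 13 * (level n : ℝ) ^ 3 := by ring

theorem log_le_fan (h : level n ≠ 0) : Real.log n ≤ 13 * fan n := by
  refine (log_le h).trans ?_
  have : ((level n ^ 3 : ℕ) : ℝ) ≤ fan n := by exact_mod_cast cube_le_two_pow_sq (level n)
  push_cast at this
  linarith

end Parameters

/-! ### The probability of success -/

section Success

variable {k n : ℕ} {q : ℝ}

theorem evalPairs_add (h h' : Pair n → ZMod k) (c : Pair n → ℤ) :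
    evalPairs (fun p => h p + h' p) c = evalPairs h c + evalPairs h' c := by
  simp [evalPairs, Finset.sum_add_distrib]

theorem block_end_le (h : level n ≠ 0) {ρ : ℕ} (hρ : ρ < fan n) :
    1 + ρ * blockSize n + blockSize n ≤ n := by
  have h1 := threshold_level_lt h
  rw [← fan_mul_blockSize] at h1
  have h2 := Nat.mul_le_mul_right (blockSize n) (Nat.succ_le_of_lt hρ)
  rw [Nat.succ_mul] at h2
  omega

variable [Nonempty (Pair n)] {m : ℕ}

/-- The queried pairs as pairs of numbers. -/
noncomputable def queries (e : Fin m → Pair n) (j : ℕ) : ℕ × ℕ :=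
  ((extend e j).1.1, (extend e j).1.2)

/-- The search tree number `ρ` with formal answers. -/
noncomputable def symbolicTree (e : Fin m → Pair n) (ρ : ℕ) : Exploration (Pair n → ℤ) :=
  searchTree n (queries e) (fun j => Pi.single (extend e j) 1) ρ (level n + level n)

/-- All rounds of all trees expand. -/
def GoodQueries (e : Fin m → Pair n) : Prop :=
  ∀ ρ < fan n, ∀ i < level n + level n, Expanding n (1 + ρ * blockSize n) (blockSize n) (fan n)
    (level n) (roundLength n) fun τ => extend e
      (ρ * ((level n + level n) * roundLength n) + (i * roundLength n + τ))

theorem GoodQueries.stage_ne_zero {e : Fin m → Pair n} (he : GoodQueries e) (h : level n ≠ 0)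
    {ρ : ℕ} (hρ : ρ < fan n) (x : Fin n) : (symbolicTree e ρ).stage x ≠ 0 :=
  Exploration.grow_stage_ne_zero_of_expanding (by omega) (block_end_le h hρ) (fan_pos n)
    (Nat.pos_of_ne_zero h) (blockSize_eq n) (he ρ hρ) x

theorem searchTree_answer (g : Fin n → ZMod k) (err : Pair n → ZMod k) (e : Fin m → Pair n)
    (ρ : ℕ) :
    searchTree n (queries e) (fun j => answer g err (extend e j)) ρ (level n + level n) =
      (symbolicTree e ρ).map (evalPairs (answer g err)) := by
  rw [symbolicTree, searchTree, searchTree, ← Exploration.map_grow]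
  simp only [evalPairs_single]

theorem symbolic_symbolicTree (g : ℕ → ZMod k) (e : Fin m → Pair n) (ρ : ℕ) :
    Symbolic (1 + ρ * blockSize n) (blockSize n) g (symbolicTree e ρ) :=
  symbolic_grow (1 + ρ * blockSize n) (blockSize n) (roundLength n) g
    (fun j => extend e (ρ * ((level n + level n) * roundLength n) + j)) (level n + level n)

/-- The hidden assignment as a function on the natural numbers. -/
def extendZero (g : Fin n → ZMod k) (v : ℕ) : ZMod k := if h : v < n then g ⟨v, h⟩ else 0

/-- The estimate of a tree is the truth plus the errors along the path. -/
theorem lab_searchTree (g : Fin n → ZMod k) (err : Pair n → ZMod k) {e : Fin m → Pair n}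
    {ρ : ℕ} {x : Fin n} (hx : (symbolicTree e ρ).stage x ≠ 0) :
    (searchTree n (queries e) (fun j => answer g err (extend e j)) ρ (level n + level n)).lab x =
      g x - extendZero g 0 + evalPairs err ((symbolicTree e ρ).lab x) := by
  have h1 := (symbolic_symbolicTree (extendZero g) e ρ).potential x hx
  have h2 : answer g err = fun p : Pair n =>
      (extendZero g p.1.1 - extendZero g p.1.2) + err p := by
    funext p
    simp [answer, extendZero]
  have h3 : extendZero g x = g x := by simp [extendZero]
  rw [searchTree_answer, Exploration.map, h2]
  simp only
  rw [evalPairs_add, h1, h3]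

theorem votes_eq (g : Fin n → ZMod k) (err : Pair n → ZMod k) {e : Fin m → Pair n}
    (he : GoodQueries e) (h : level n ≠ 0) (x : Fin n) (d : ZMod k) :
    votes n (queries e) (fun j => answer g err (extend e j)) (fan n) x
      (g x - extendZero g 0 + d) =
      (Finset.univ.filter fun ρ : Fin (fan n) =>
        evalPairs err ((symbolicTree e ρ).lab x) = d).card := by
  classical
  rw [votes, ← Finset.card_map Fin.valEmbedding]
  congr 1
  ext ρ
  simp only [Finset.mem_filter, Finset.mem_range, Finset.mem_map, Finset.mem_univ, true_and,
    Fin.valEmbedding_apply]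
  have hst : ∀ ρ, (searchTree n (queries e) (fun j => answer g err (extend e j)) ρ
      (level n + level n)).stage x = (symbolicTree e ρ).stage x := by
    intro ρ
    rw [searchTree_answer]; rfl
  constructor
  · rintro ⟨h1, h2, h3⟩
    rw [hst] at h2
    rw [lab_searchTree g err h2] at h3
    exact ⟨⟨ρ, h1⟩, add_left_cancel h3, rfl⟩
  · rintro ⟨ρ, h1, rfl⟩
    have h2 := he.stage_ne_zero h ρ.2 x
    exact ⟨ρ.2, by rw [hst]; exact h2, by rw [lab_searchTree g err h2, h1]⟩

theorem answers_queries (g : Fin n → ZMod k) (err : Pair n → ZMod k) (e : Fin m → Pair n) :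
    Answers n (responses g err e) (queries e) fun j => answer g err (extend e j) := by
  intro j hj
  simp [responses, queries, extend, hj]

variable [NeZero k]

/-- The errors favour the value `d ≠ 0` over the value `0` in the vote on some item. -/
def BadErrors (k : ℕ) (e : Fin m → Pair n) (err : Pair n → ZMod k) : Prop :=
  ∃ x : Fin n, ∃ d : ZMod k, d ≠ 0 ∧
    (Finset.univ.filter fun ρ : Fin (fan n) => evalPairs err ((symbolicTree e ρ).lab x) = 0).card ≤
    (Finset.univ.filter fun ρ : Fin (fan n) => evalPairs err ((symbolicTree e ρ).lab x) = d).card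

theorem mem_successEvent (g : Fin n → ZMod k) {err : Pair n → ZMod k} {e : Fin m → Pair n}
    (hm : queryCount n ≤ m) (h : level n ≠ 0) (he : GoodQueries e) (herr : ¬ BadErrors k e err) :
    (err, e) ∈ successEvent m (clustering k) g := by
  obtain ⟨t, T, h1, -, h2⟩ := triple_clustering (answers_queries g err e) hm (State.init n) rfl
  refine ⟨t, T, h1, ?_⟩
  have h3 : ∀ x : Fin n, t.arr 0 x = (g x - extendZero g 0).val := by
    intro x
    obtain ⟨b, hb, hmax⟩ := h2 x x.2
    rw [hb]
    congr 1
    by_contra hne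
    refine herr ⟨x, b - (g x - extendZero g 0), sub_ne_zero.2 hne, ?_⟩
    rw [← votes_eq g err he h, ← votes_eq g err he h, add_zero, add_sub_cancel]
    exact hmax _
  intro x y
  rw [h3, h3, (ZMod.val_injective k).eq_iff, sub_left_inj]

theorem queryLaw_not_goodQueries_le (hm : queryCount n ≤ m) (h : level n ≠ 0)
    (hfan : 54 ≤ fan n) :
    (queryLaw n m).real {e | ¬ GoodQueries e} ≤
      fan n * ((level n + level n) * (level n * Real.exp (-(fan n : ℝ) ^ 2))) := by
  have hsub : {e : Fin m → Pair n | ¬ GoodQueries e} ⊆ ⋃ ρ ∈ Finset.range (fan n),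
      ⋃ i ∈ Finset.range (level n + level n), {e | ¬ Expanding n (1 + ρ * blockSize n)
        (blockSize n) (fan n) (level n) (roundLength n) fun τ => extend e
          (ρ * ((level n + level n) * roundLength n) + i * roundLength n + τ)} := by
    intro e he
    simp only [Set.mem_ofPred_eq, GoodQueries, not_forall] at he
    obtain ⟨ρ, hρ, i, hi, hno⟩ := he
    simp only [Set.mem_iUnion, Finset.mem_range]
    refine ⟨ρ, hρ, i, hi, ?_⟩
    simp only [Set.mem_ofPred_eq, Nat.add_assoc] at hno ⊢
    exact hno
  refine (measureReal_mono hsub (measure_ne_top _ _)).trans ?_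
  refine (measureReal_biUnion_finset_le _ _).trans ?_
  calc _ ≤ ∑ _ρ ∈ Finset.range (fan n), ((level n + level n : ℝ) *
        (level n * Real.exp (-(fan n : ℝ) ^ 2))) := by
        refine Finset.sum_le_sum fun ρ hρ => (measureReal_biUnion_finset_le _ _).trans ?_
        calc _ ≤ ∑ _i ∈ Finset.range (level n + level n),
              (level n * Real.exp (-(fan n : ℝ) ^ 2)) := by
              refine Finset.sum_le_sum fun i hi => ?_
              rw [Finset.mem_range] at hρ hi
              refine queryLaw_not_expanding_le ?_ (block_end_le h hρ) (blockSize_eq n) (fan_pos n)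
                (le_fan_pow h) (roundLength_eq n) (log_le_fan h) hfan
              have h1 : (ρ + 1) * ((level n + level n) * roundLength n) ≤ m :=
                (Nat.mul_le_mul_right _ hρ).trans hm
              have h2 := Nat.mul_le_mul_right (roundLength n) (Nat.succ_le_of_lt hi)
              rw [Nat.succ_mul] at h1 h2
              omega
          _ = _ := by simp
    _ = _ := by simp

theorem errorsLaw_badErrors_le (hq0 : 0 ≤ q) (hq : q ≤ 1 / 2) (h : level n ≠ 0)
    {e : Fin m → Pair n} (he : GoodQueries e) :
    (errorsLaw k n q).real {err | BadErrors k e err} ≤ n * (k * Real.exp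
      (-(fan n * ((1 - 2 * q) ^ (level n + level n)) ^ 2 / 2))) := by
  classical
  have := isProbabilityMeasure_errorLaw (k := k) hq0 (hq.trans (by norm_num))
  have hsub : {err : Pair n → ZMod k | BadErrors k e err} ⊆ ⋃ x ∈ (Finset.univ : Finset (Fin n)),
      ⋃ d ∈ Finset.univ.filter fun d : ZMod k => d ≠ 0, {err |
      (Finset.univ.filter fun ρ : Fin (fan n) =>
        evalPairs err ((symbolicTree e ρ).lab x) = 0).card ≤
      (Finset.univ.filter fun ρ : Fin (fan n) =>
        evalPairs err ((symbolicTree e ρ).lab x) = d).card} := by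
    rintro err ⟨x, d, hd, hle⟩
    simp only [Set.mem_iUnion, Finset.mem_univ, Finset.mem_filter, true_and]
    exact ⟨x, trivial, d, hd, hle⟩
  refine (measureReal_mono hsub (measure_ne_top _ _)).trans
    ((measureReal_biUnion_finset_le _ _).trans ?_)
  set δ := Real.exp (-(fan n * ((1 - 2 * q) ^ (level n + level n)) ^ 2 / 2))
  calc _ ≤ ∑ _x : Fin n, (k * δ : ℝ) := by
        refine Finset.sum_le_sum fun x _ => (measureReal_biUnion_finset_le _ _).trans ?_
        calc _ ≤ ∑ _d ∈ Finset.univ.filter fun d : ZMod k => d ≠ 0, δ := by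
              refine Finset.sum_le_sum fun d hd => ?_
              have hsym := fun ρ => symbolic_symbolicTree (0 : ℕ → ZMod k) e ρ
              have hst := fun ρ : Fin (fan n) => he.stage_ne_zero h ρ.2 x
              refine errorsLaw_vote_le hq0 hq (fun ρ => (symbolicTree e ρ).lab x)
                (fun ρ p hp => (hsym ρ).coeff x (hst ρ) p hp) ?_ ?_ (Finset.mem_filter.1 hd).2
              · intro ρ σ hρσ p hp
                by_contra hp'
                refine not_touches_of_touches (by omega) (by omega) ?_
                  ((hsym ρ).touches x (hst ρ) p hp) ((hsym σ).touches x (hst σ) p hp')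
                rcases lt_or_gt_of_ne (fun h => hρσ (Fin.ext h) : (ρ : ℕ) ≠ σ) with h | h
                · left
                  have := Nat.mul_le_mul_right (blockSize n) (Nat.succ_le_of_lt h)
                  rw [Nat.succ_mul] at this
                  omega
                · right
                  have := Nat.mul_le_mul_right (blockSize n) (Nat.succ_le_of_lt h)
                  rw [Nat.succ_mul] at this
                  omega
              · intro ρ
                have h1 := (hsym ρ).length x (hst ρ)
                have h2 : (symbolicTree e ρ).stage x ≤ level n + level n + 1 :=
                  Exploration.grow_stage_le _ _
                omega
          _ ≤ ∑ _d : ZMod k, δ :=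
              Finset.sum_le_sum_of_subset_of_nonneg (Finset.filter_subset _ _)
                fun _ _ _ => (Real.exp_pos _).le
          _ = k * δ := by simp [ZMod.card]
    _ = _ := by simp

/-- A bound for the probability that the algorithm does not recover the clusters. -/
noncomputable def failureBound (k n : ℕ) (q : ℝ) : ℝ :=
  fan n * ((level n + level n) * (level n * Real.exp (-(fan n : ℝ) ^ 2))) +
    n * (k * Real.exp (-(fan n * ((1 - 2 * q) ^ (level n + level n)) ^ 2 / 2)))

theorem modelLaw_success (hq0 : 0 ≤ q) (hq : q ≤ 1 / 2) (hm : queryCount n ≤ m) (h : level n ≠ 0)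
    (hfan : 54 ≤ fan n) (g : Fin n → ZMod k) :
    1 - ENNReal.ofReal (failureBound k n q) ≤
      modelLaw k n m q (successEvent m (clustering k) g) := by
  have := isProbabilityMeasure_errorLaw (k := k) hq0 (hq.trans (by norm_num))
  have : IsProbabilityMeasure (modelLaw k n m q) := by unfold modelLaw; infer_instance
  have hc : modelLaw k n m q (successEvent m (clustering k) g)ᶜ ≤
      ENNReal.ofReal (failureBound k n q) := by
    have hsub : (successEvent m (clustering k) g)ᶜ ⊆
        (Set.univ ×ˢ {e | ¬ GoodQueries e}) ∪ {w | GoodQueries w.2 ∧ BadErrors k w.2 w.1} := by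
      rintro ⟨err, e⟩ hw
      by_cases he : GoodQueries e
      · right
        refine ⟨he, ?_⟩
        by_contra herr
        exact hw (mem_successEvent g hm h he herr)
      · exact Or.inl ⟨trivial, he⟩
    refine (measure_mono hsub).trans ((measure_union_le _ _).trans ?_)
    unfold failureBound
    rw [ENNReal.ofReal_add (by positivity) (by positivity)]
    refine add_le_add ?_ ?_
    · rw [modelLaw, Measure.prod_prod, measure_univ, one_mul,
        ENNReal.le_ofReal_iff_toReal_le (measure_ne_top _ _) (by positivity)]
      exact queryLaw_not_goodQueries_le hm h hfan
    · rw [modelLaw, Measure.prod_apply_symm MeasurableSet.of_discrete]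
      calc _ ≤ ∫⁻ _e : Fin m → Pair n, ENNReal.ofReal (n * (k * Real.exp
            (-(fan n * ((1 - 2 * q) ^ (level n + level n)) ^ 2 / 2)))) ∂queryLaw n m := by
            refine lintegral_mono fun e => ?_
            by_cases he : GoodQueries e
            · rw [ENNReal.le_ofReal_iff_toReal_le (measure_ne_top _ _) (by positivity)]
              refine le_trans (measureReal_mono ?_ (measure_ne_top _ _))
                (errorsLaw_badErrors_le (k := k) hq0 hq h he)
              intro err herr
              exact herr.2
            · have : (fun err : Pair n → ZMod k => (err, e)) ⁻¹'
                  {w | GoodQueries w.2 ∧ BadErrors k w.2 w.1} = ∅ := by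
                ext err
                simp [he]
              rw [this]
              simp
        _ = _ := by simp
  have h1 := prob_compl_eq_one_sub (μ := modelLaw k n m q)
    (MeasurableSet.of_discrete (s := (successEvent m (clustering k) g)ᶜ))
  rw [compl_compl] at h1
  rw [h1]
  exact tsub_le_tsub_left hc 1

end Success

/-! ### Asymptotics -/

section Asymptotics

open Filter Topology

theorem tendsto_level : Tendsto level atTop atTop := by
  refine tendsto_atTop.2 fun b => ?_
  filter_upwards [eventually_gt_atTop (threshold b)] with n hn
  exact Nat.le_findGreatest ((lt_threshold b).trans hn).le hn

theorem level_le_fan (n : ℕ) : level n ≤ fan n := by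
  calc level n ≤ level n * level n := Nat.le_mul_self _
    _ ≤ fan n := Nat.lt_two_pow_self.le

theorem tendsto_fan : Tendsto fan atTop atTop := tendsto_atTop_mono level_le_fan tendsto_level

/-- The exponent in Hoeffding's bound outgrows `log n`, because `2 ^ (w * w) * θ ^ w = (2 ^ w * θ) ^ w`
for `θ = (1 - 2 q) ^ 4`. -/
theorem eventually_vote_exponent {q : ℝ} (hq : q < 1 / 2) : ∀ᶠ w : ℕ in atTop,
    13 * (w : ℝ) ^ 3 + w ≤ (2 : ℝ) ^ (w * w) * ((1 - 2 * q) ^ (w + w)) ^ 2 / 2 := by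
  set θ : ℝ := (1 - 2 * q) ^ 4 with hθ
  have hθ0 : 0 < θ := pow_pos (by linarith) 4
  have h1 : ∀ᶠ w : ℕ in atTop, 2 / θ ≤ (2 : ℝ) ^ w :=
    (tendsto_pow_atTop_atTop_of_one_lt one_lt_two).eventually_ge_atTop _
  have h2 : ∀ᶠ w : ℕ in atTop, (w : ℝ) ^ 3 / (2 : ℝ) ^ w ≤ 1 / 28 :=
    (tendsto_pow_const_div_const_pow_of_one_lt 3 one_lt_two).eventually_le_const (by norm_num)
  filter_upwards [h1, h2, eventually_ge_atTop 1] with w h1 h2 hw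
  rw [div_le_iff₀ hθ0] at h1
  rw [div_le_iff₀ (by positivity)] at h2
  have h3 : (2 : ℝ) ^ w ≤ (2 : ℝ) ^ (w * w) * ((1 - 2 * q) ^ (w + w)) ^ 2 := by
    calc (2 : ℝ) ^ w ≤ (2 ^ w * θ) ^ w := pow_le_pow_left₀ (by norm_num) h1 w
      _ = _ := by rw [hθ, mul_pow, ← pow_mul, ← pow_mul, ← pow_mul]; ring_nf
  have h4 : (w : ℝ) ≤ (w : ℝ) ^ 3 := le_self_pow₀ (by exact_mod_cast hw) (by norm_num)
  linarith

theorem tendsto_failureBound (k : ℕ) {q : ℝ} (hq : q < 1 / 2) :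
    Tendsto (fun n => failureBound k n q) atTop (𝓝 0) := by
  have hfan : Tendsto (fun n => (fan n : ℝ)) atTop atTop :=
    tendsto_natCast_atTop_atTop.comp tendsto_fan
  have hlevel : Tendsto (fun n => (level n : ℝ)) atTop atTop :=
    tendsto_natCast_atTop_atTop.comp tendsto_level
  have h1 : Tendsto (fun n => (fan n : ℝ) * ((level n + level n) *
      (level n * Real.exp (-(fan n : ℝ) ^ 2)))) atTop (𝓝 0) := by
    have h2 : Tendsto (fun n => 2 * ((fan n : ℝ) ^ 3 * Real.exp (-(fan n : ℝ)))) atTop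
        (𝓝 (2 * 0)) :=
      ((Real.tendsto_pow_mul_exp_neg_atTop_nhds_zero 3).comp hfan).const_mul 2
    rw [mul_zero] at h2
    refine squeeze_zero (fun n => by positivity) (fun n => ?_) h2
    have h3 : (level n : ℝ) ≤ fan n := by exact_mod_cast level_le_fan n
    have h4 : (fan n : ℝ) ≤ (fan n : ℝ) ^ 2 :=
      le_self_pow₀ (by exact_mod_cast fan_pos n) (by norm_num)
    calc (fan n : ℝ) * ((level n + level n) * (level n * Real.exp (-(fan n : ℝ) ^ 2)))
        ≤ (fan n : ℝ) * ((fan n + fan n) * (fan n * Real.exp (-(fan n : ℝ)))) := by gcongr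
      _ = _ := by ring
  have h2 : Tendsto (fun n : ℕ => (n : ℝ) * (k * Real.exp
      (-(fan n * ((1 - 2 * q) ^ (level n + level n)) ^ 2 / 2)))) atTop (𝓝 0) := by
    have h3 : Tendsto (fun n => (k : ℝ) * Real.exp (-(level n : ℝ))) atTop (𝓝 (k * 0)) :=
      (Real.tendsto_exp_neg_atTop_nhds_zero.comp hlevel).const_mul _
    rw [mul_zero] at h3
    refine squeeze_zero' (Eventually.of_forall fun n => by positivity) ?_ h3
    filter_upwards [tendsto_level.eventually (eventually_vote_exponent hq),
      tendsto_level.eventually_gt_atTop 0, eventually_gt_atTop 0] with n h4 h5 h6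
    have h7 : (n : ℝ) ≤ Real.exp (13 * (level n : ℝ) ^ 3) := by
      rw [← Real.exp_log (show (0 : ℝ) < n by exact_mod_cast h6)]
      exact Real.exp_le_exp.2 (log_le h5.ne')
    have h8 : (fan n : ℝ) = (2 : ℝ) ^ (level n * level n) := by simp [fan]
    rw [h8]
    calc _ ≤ Real.exp (13 * (level n : ℝ) ^ 3) * (k * Real.exp
          (-((2 : ℝ) ^ (level n * level n) * ((1 - 2 * q) ^ (level n + level n)) ^ 2 / 2))) := by
          gcongr
      _ = k * Real.exp (13 * (level n : ℝ) ^ 3 -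
          (2 : ℝ) ^ (level n * level n) * ((1 - 2 * q) ^ (level n + level n)) ^ 2 / 2) := by
          rw [sub_eq_add_neg (13 * _), Real.exp_add]; ring
      _ ≤ k * Real.exp (-(level n : ℝ)) := by gcongr; linarith
  simpa [failureBound] using h1.add h2

theorem cube_mul_log_two_le {n : ℕ} (h : level n ≠ 0) :
    (level n : ℝ) ^ 3 * Real.log 2 ≤ Real.log n := by
  have h1 : 2 ^ (level n ^ 3) ≤ n := by
    refine le_trans ?_ (threshold_level_lt h).le
    rw [threshold, ← pow_succ']
    refine Nat.pow_le_pow_right two_pos ?_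
    nlinarith
  have h2 : (2 : ℝ) ^ (level n ^ 3) ≤ n := by exact_mod_cast h1
  have h3 := Real.log_le_log (by positivity) h2
  rw [Real.log_pow] at h3
  exact_mod_cast h3

theorem eventually_log_level : ∀ᶠ w : ℕ in atTop,
    16 * (Real.log 13 + 3 * Real.log w) ≤ (w : ℝ) ∧ 4 ≤ (w : ℝ) := by
  have h1 : Tendsto (fun w : ℕ => Real.log w / (w : ℝ)) atTop (𝓝 0) := by
    have := Real.isLittleO_log_id_atTop.tendsto_div_nhds_zero
    exact this.comp tendsto_natCast_atTop_atTop
  have h2 : Tendsto (fun w : ℕ => (w : ℝ)) atTop atTop := tendsto_natCast_atTop_atTop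
  filter_upwards [h1.eventually_le_const (show (0 : ℝ) < 1 / 96 by norm_num),
    h2.eventually_ge_atTop (32 * Real.log 13), h2.eventually_ge_atTop 4] with w h3 h4 h5
  rw [div_le_iff₀ (by linarith)] at h3
  exact ⟨by linarith, h5⟩

theorem isBigO_queryCount : (fun n : ℕ => (queryCount n : ℝ)) =O[atTop]
    fun n : ℕ => (n : ℝ) ^ (1 + 1 / Real.log (Real.log (n : ℝ))) * Real.log (n : ℝ) := by
  refine Asymptotics.IsBigO.of_bound 1 ?_
  filter_upwards [tendsto_level.eventually eventually_log_level] with n hn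
  obtain ⟨hw, hw4⟩ := hn
  have h0 : level n ≠ 0 := by
    intro h; rw [h] at hw4; norm_num at hw4
  have hn0 : (0 : ℝ) < n := by
    exact_mod_cast (Nat.zero_le _).trans_lt (threshold_level_lt h0)
  set w : ℝ := (level n : ℝ) with hwdef
  have hlog2 : (1 / 2 : ℝ) ≤ Real.log 2 := by linarith [Real.log_two_gt_d9]
  have h1 : w ^ 3 * Real.log 2 ≤ Real.log n := cube_mul_log_two_le h0
  have h2 : Real.log n ≤ 13 * w ^ 3 := log_le h0
  have h3 : 2 * w ≤ Real.log n := by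
    refine le_trans ?_ h1
    calc 2 * w ≤ w ^ 3 * (1 / 2) := by nlinarith [mul_self_nonneg w, mul_le_mul hw4 hw4 (by norm_num) (by linarith)]
      _ ≤ _ := by gcongr
  have h4 : 1 < Real.log n := by linarith
  have h5 : 0 < Real.log (Real.log n) := Real.log_pos h4
  have h6 : Real.log (Real.log n) ≤ Real.log 13 + 3 * Real.log w := by
    have := Real.log_le_log (by linarith) h2
    rw [Real.log_mul (by norm_num) (by positivity), Real.log_pow] at this
    exact_mod_cast this
  have h7 : (2 : ℝ) ^ (16 * (level n * level n)) ≤ (n : ℝ) ^ (1 / Real.log (Real.log n)) := by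
    rw [Real.rpow_def_of_pos hn0, ← Real.exp_log (show (0 : ℝ) < 2 by norm_num),
      ← Real.exp_nat_mul]
    refine Real.exp_le_exp.2 ?_
    rw [mul_one_div, le_div_iff₀ h5]
    push_cast
    rw [← hwdef]
    calc 16 * (w * w) * Real.log 2 * Real.log (Real.log n)
        ≤ 16 * (w * w) * Real.log 2 * (Real.log 13 + 3 * Real.log w) := by gcongr
      _ = w * w * Real.log 2 * (16 * (Real.log 13 + 3 * Real.log w)) := by ring
      _ ≤ w * w * Real.log 2 * w := by gcongr
      _ = w ^ 3 * Real.log 2 := by ring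
      _ ≤ Real.log n := h1
  have h8 : (queryCount n : ℝ) = n * (2 : ℝ) ^ (16 * (level n * level n)) * (2 * w) := by
    rw [queryCount, roundLength, fan]
    push_cast
    rw [← hwdef]
    ring
  rw [one_mul, Real.norm_of_nonneg (by positivity), Real.norm_of_nonneg
    (mul_nonneg (by positivity) (by linarith)), h8, Real.rpow_add hn0, Real.rpow_one]
  gcongr

end Asymptotics

/-! ### The running time -/

section Time

theorem level_le (n : ℕ) : level n ≤ n := Nat.findGreatest_le n

theorem fan_le (n : ℕ) : fan n ≤ n + 1 := by
  by_cases h : level n = 0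
  · simp [fan, h]
  · have h1 := threshold_level_lt h
    rw [← fan_mul_blockSize] at h1
    have h2 : 0 < blockSize n := Nat.mul_pos two_pos (Nat.two_pow_pos _)
    have h3 := Nat.le_mul_of_pos_right (fan n) h2
    omega

theorem runTime_mono {k n w w' F F' N N' : ℕ} (hw : w ≤ w') (hF : F ≤ F') (hN : N ≤ N') :
    runTime k n w F N ≤ runTime k n w' F' N' := by
  unfold runTime paramsTime treeTime scaleTime
  gcongr

open Polynomial in
theorem exists_polynomial_runTime (k : ℕ) : ∃ p : Polynomial ℕ, ∀ n,
    runTime k n (level n) (fan n) (roundLength n) ≤ p.eval n := by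
  let S : ℕ[X] → ℕ[X] → ℕ[X] → ℕ[X] := fun a b c => a * (b * (c * 20 + 20) + 20) + 20
  let N : ℕ[X] := X * (X + 1) ^ 15
  refine ⟨(X * (S X X (X + 1) + 40) + (2 * S X X X + S X X 1 + S X X 15) + 40) +
    (X + 1) * ((X * 20 + ((X + X) * (N * 257 + 14) + X * (2 * (cellCost k : ℕ[X]) + 40)) + 50) +
      20) + X * ((k : ℕ[X]) * (2 * (cellCost k : ℕ[X]) + 40) + 40) + 40, fun n => ?_⟩
  refine (runTime_mono (level_le n) (fan_le n) (N' := n * (n + 1) ^ 15) ?_).trans (le_of_eq ?_)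
  · rw [roundLength_eq]
    exact Nat.mul_le_mul_left _ (Nat.pow_le_pow_left (fan_le n) 15)
  · simp [S, N, runTime, paramsTime, treeTime, scaleTime]

/-- The program halts within its time bound for all queries and errors. -/
theorem exists_exec {k n : ℕ} [NeZero k] (g : Fin n → ZMod k) (err : Pair n → ZMod k)
    (e : Fin (queryCount n) → Pair n) : ∃ (t : State) (T : ℕ),
      Exec (responses g err e) (clustering k) (State.init n) t T ∧
        T ≤ runTime k n (level n) (fan n) (roundLength n) := by
  have key : ∀ (q : ℕ → ℕ × ℕ) (r : ℕ → ZMod k), Answers n (responses g err e) q r → _ :=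
    fun q r h => triple_clustering h le_rfl (State.init n) rfl
  -- without any pair of items there are no queries
  by_cases hne : Nonempty (Pair n)
  · obtain ⟨t, T, h1, h2, -⟩ := key _ _ (answers_queries g err e)
    exact ⟨t, T, h1, h2⟩
  · obtain ⟨t, T, h1, h2, -⟩ := key (fun _ => (0, 0)) (fun _ => 0)
      fun j hj => absurd ⟨e ⟨j, hj⟩⟩ hne
    exact ⟨t, T, h1, h2⟩

end Time

end NoisyClustering

open NoisyClustering in
theorem theorem2 (k : ℕ) [NeZero k] :
    ∃ (P : Prog) (time : Polynomial ℕ) (m : ℕ → ℕ),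
      ((fun n : ℕ => (m n : ℝ)) =O[Filter.atTop]
        fun n : ℕ => (n : ℝ) ^ (1 + 1 / Real.log (Real.log (n : ℝ))) * Real.log (n : ℝ)) ∧
      (∀ (n : ℕ) (g : Fin n → ZMod k) (err : Pair n → ZMod k) (e : Fin (m n) → Pair n),
        ∃ (t : State) (T : ℕ),
          Exec (responses g err e) P (State.init n) t T ∧ T ≤ time.eval n) ∧
      ∀ q : ℝ, 0 < q → q < 1 / 2 → ∀ g : (n : ℕ) → Fin n → ZMod k,
        Filter.Tendsto (fun n : ℕ => modelLaw k n (m n) q (successEvent (m n) P (g n)))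
          Filter.atTop (nhds 1) := by
  obtain ⟨time, htime⟩ := exists_polynomial_runTime k
  refine ⟨clustering k, time, queryCount, isBigO_queryCount, fun n g err e => ?_,
    fun q hq0 hq g => ?_⟩
  · obtain ⟨t, T, h1, h2⟩ := exists_exec g err e
    exact ⟨t, T, h1, h2.trans (htime n)⟩
  · have hnonempty : ∀ n, 2 ≤ n → Nonempty (Pair n) := fun n hn =>
      ⟨⟨(⟨0, by omega⟩, ⟨1, by omega⟩), by simp [Fin.lt_def]⟩⟩
    have hlower : Filter.Tendsto (fun n => 1 - ENNReal.ofReal (failureBound k n q)) Filter.atTop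
        (nhds 1) := by
      have h1 := ENNReal.tendsto_ofReal (tendsto_failureBound k hq)
      have h2 := ENNReal.Tendsto.sub (tendsto_const_nhds (x := (1 : ENNReal))) h1
        (Or.inl ENNReal.one_ne_top)
      simpa using h2
    refine tendsto_of_tendsto_of_tendsto_of_le_of_le' hlower tendsto_const_nhds ?_ ?_
    · filter_upwards [tendsto_level.eventually_gt_atTop 0, tendsto_fan.eventually_ge_atTop 54,
        Filter.eventually_ge_atTop 2] with n h1 h2 h3
      have := hnonempty n h3
      exact modelLaw_success hq0.le hq.le le_rfl h1.ne' h2 (g n)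
    · filter_upwards [Filter.eventually_ge_atTop 2] with n h1
      have := hnonempty n h1
      have := isProbabilityMeasure_errorLaw (k := k) hq0.le (hq.le.trans (by norm_num))
      have : MeasureTheory.IsProbabilityMeasure (modelLaw k n (queryCount n) q) := by
        unfold modelLaw; infer_instance
      exact MeasureTheory.prob_le_one
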